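/- Every 2-dimensional flat torus, of any modulus, admits an origami embedding in $\mathbb{R}^3$. In detail: let $\omega_1,\omega_2\in\mathbb{C}$ with $\omega_1\neq 0$ be such that the modulus $\tau=\omega_2/\omega_1$ is not real (in particular $\tau$ may be any point of the fundamental domain $\{|\mathrm{Re}\,\tau|\le \tfrac12,\ |\tau|\ge 1\}$). Then there is an origami embedding $f$ of the flat torus $\mathbb{C}/(\mathbb{Z}\omega_1+\mathbb{Z}\omega_2)$ in Euclidean 3-space, i.e. a topological embedding $f:\mathbb{C}/(\mathbb{Z}\omega_1+\mathbb{Z}\omega_2)\to\mathbb{R}^3$ which is piecewise linear and isometric on each flat piece: the torus is covered by the images of finitely many nondegenerate Euclidean triangles of $\mathbb{C}$, on each of which $f$, composed with the projection from $\mathbb{C}$, is the restriction of an affine isometric map $\mathbb{C}\to\mathbb{R}^3$. -/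

import Mathlib

/-- The lattice `ℤ ω₁ + ℤ ω₂` in the Euclidean plane `ℂ`. -/
def periodLattice (ω₁ ω₂ : ℂ) : AddSubgroup ℂ :=
  AddSubgroup.closure {ω₁, ω₂}

/-- The torus `ℂ / (ℤ ω₁ + ℤ ω₂)` with the quotient topology. When `ω₂ / ω₁` is not real it is
the flat torus of modulus `ω₂ / ω₁`: its flat metric is the one for which the quotient map from
the Euclidean plane `ℂ` is a local isometry. -/
abbrev FlatTorus (ω₁ ω₂ : ℂ) : Type :=
  ℂ ⧸ periodLattice ω₁ ω₂

/-- An origami embedding of a flat torus in Euclidean 3-space: a topological embedding which is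
piecewise linear and isometric on each flat piece. That is, the torus is covered by the images of
finitely many nondegenerate triangles of the plane such that on each of these triangles the map
is the restriction of an affine isometric map `ℂ → ℝ³`. (Intersecting the triangles refines such
a finite cover to a triangulation with the same property, so it is immaterial whether the pieces
are allowed to overlap.) -/
structure IsOrigamiEmbedding {ω₁ ω₂ : ℂ} (f : FlatTorus ω₁ ω₂ → EuclideanSpace ℝ (Fin 3)) :
    Prop where
  isEmbedding : Topology.IsEmbedding f
  exists_pieces : ∃ pieces : Set (Affine.Triangle ℝ ℂ), pieces.Finite ∧
    (∀ p : FlatTorus ω₁ ω₂, ∃ T ∈ pieces, ∃ z ∈ convexHull ℝ (Set.range T.points),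
      (QuotientAddGroup.mk z : FlatTorus ω₁ ω₂) = p) ∧
    ∀ T ∈ pieces, ∃ A : ℂ →ᵃⁱ[ℝ] EuclideanSpace ℝ (Fin 3),
      ∀ z ∈ convexHull ℝ (Set.range T.points), f (QuotientAddGroup.mk z) = A z

/-! Roll the torus into two nested walls with common rims. Let `δ = π / n`. A strip of twist `β`
joins a regular `n`-gon inscribed in the unit circle to a parallel copy turned by `β + δ`, through
`2 * n` alternating triangles; unrolled, it is a flat annulus of circumference `2 * n * sin δ`. Two
strips of the same height, of twists `-b` and `β = -b + 2 * δ * j`, have the same lower and the same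
upper polygon. Glued along both, they form a flat torus, with modulus read off from the unrolling:
the translation along the rims is `2 * j * sin δ - sin b - sin β`, and the transverse period is the
sum of the two slant heights.

The surface is embedded for two reasons. Each horizontal section of one strip is a simple polygon
(`stripPoint_eq_iff`). The more twisted strip has a narrow waist and stays strictly on the inner
side of planes which the faces of the other strip do not cross (`stripPoint_ne`); this needs only
`cos ((β - δ) / 2) < (cos δ + cos b) / 2`.

Up to similarity, reflection and change of basis the modulus is `x + y * I` with `0 ≤ x ≤ 1 / 2` and
`x ^ 2 + y ^ 2 ≥ 1`. For `x > 0`, taking `n` large and `b` near `β / 2`, the twists can be adjusted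
to give `x` exactly (`exists_strip_parameters`), and the height of the strips then gives `y`
(`exists_heights`). For `x = 0` the outer wall is a prism and the inner one is half of a strip with
its mirror image, whose shears cancel (`foldable_of_prism`). -/

section

open Complex Set

/-! ### From isometric cells to origami embeddings. -/

/-- The convex hull of the vertices of a triangle of the plane. -/
def triHull (T : Affine.Triangle ℝ ℂ) : Set ℂ := convexHull ℝ (Set.range T.points)

/-- A finite union of nondegenerate triangles. -/
def Triangulable (C : Set ℂ) : Prop :=
  ∃ S : Set (Affine.Triangle ℝ ℂ), S.Finite ∧ C = ⋃ T ∈ S, triHull T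

/-- `ℂ / Λ` can be assembled in space from finitely many isometric images of triangulable cells. -/
def Foldable (Λ : AddSubgroup ℂ) : Prop :=
  ∃ (ι : Type) (_ : Finite ι) (cell : ι → Set ℂ) (A : ι → ℂ →ᵃⁱ[ℝ] EuclideanSpace ℝ (Fin 3)),
    (∀ i, Triangulable (cell i)) ∧ (∀ z, ∃ i, ∃ w ∈ cell i, z - w ∈ Λ) ∧
    ∀ i j, ∀ z ∈ cell i, ∀ w ∈ cell j, (z - w ∈ Λ ↔ A i z = A j w)

lemma isCompact_triHull (T : Affine.Triangle ℝ ℂ) : IsCompact (triHull T) :=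
  (Set.finite_range _).isCompact_convexHull ℝ

lemma Triangulable.isCompact {C : Set ℂ} (h : Triangulable C) : IsCompact C := by
  obtain ⟨S, hS, rfl⟩ := h
  exact hS.isCompact_biUnion fun T _ => isCompact_triHull T

/-- A continuous surjection from a compact space to a Hausdorff one is a quotient map. As `g` has
the same fibres as `p`, it descends to a continuous injection of a compact space, which is a closed
embedding. Applied to the disjoint union of the cells, this glues the pieces without any
combinatorics of adjacency. -/
lemma exists_isEmbedding_of_compact_cover {K X Y : Type*} [TopologicalSpace K] [CompactSpace K]
    [TopologicalSpace X] [T2Space X] [TopologicalSpace Y] [T2Space Y] (p : K → X) (g : K → Y)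
    (hp : Continuous p) (hs : Function.Surjective p) (hg : Continuous g)
    (h : ∀ a b, p a = p b ↔ g a = g b) :
    ∃ f : X → Y, Topology.IsEmbedding f ∧ ∀ a, f (p a) = g a := by
  have hq : Topology.IsQuotientMap p := (hp.isClosedMap).isQuotientMap hp hs
  have hfp : ∀ a, g (Function.surjInv hs (p a)) = g a := fun a =>
    (h _ _).1 (Function.surjInv_eq hs (p a))
  have hc : Continuous fun x => g (Function.surjInv hs x) := by
    rw [hq.continuous_iff]
    convert hg using 1
    ext1 a
    exact hfp a
  have : CompactSpace X := ⟨by rw [← hs.range_eq]; exact isCompact_range hp⟩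
  refine ⟨_, (hc.isClosedEmbedding ?_).isEmbedding, hfp⟩
  intro x y hxy
  obtain ⟨a, rfl⟩ := hs x
  obtain ⟨b, rfl⟩ := hs y
  simp only [hfp] at hxy
  exact (h a b).2 hxy

lemma exists_isOrigamiEmbedding_of_foldable {ω₁ ω₂ : ℂ} [T2Space (FlatTorus ω₁ ω₂)]
    (h : Foldable (periodLattice ω₁ ω₂)) :
    ∃ f : FlatTorus ω₁ ω₂ → EuclideanSpace ℝ (Fin 3), IsOrigamiEmbedding f := by
  obtain ⟨ι, _, cell, A, htri, hcov, hcompat⟩ := h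
  have hmk : ∀ z w : ℂ, (QuotientAddGroup.mk z : FlatTorus ω₁ ω₂) = QuotientAddGroup.mk w ↔
      z - w ∈ periodLattice ω₁ ω₂ := by
    intro z w
    rw [eq_comm, QuotientAddGroup.eq, neg_add_eq_sub]
  have : ∀ i, CompactSpace (cell i) := fun i => isCompact_iff_compactSpace.1 (htri i).isCompact
  obtain ⟨f, hf, hfA⟩ := exists_isEmbedding_of_compact_cover
    (K := Σ i, cell i) (X := FlatTorus ω₁ ω₂) (Y := EuclideanSpace ℝ (Fin 3))
    (fun a => QuotientAddGroup.mk (a.2 : ℂ)) (fun a => A a.1 a.2)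
    (continuous_sigma fun i => continuous_quotient_mk'.comp continuous_subtype_val)
    (by
      intro x
      obtain ⟨z, rfl⟩ := QuotientAddGroup.mk_surjective x
      obtain ⟨i, w, hw, hzw⟩ := hcov z
      exact ⟨⟨i, w, hw⟩, ((hmk z w).2 hzw).symm⟩)
    (continuous_sigma fun i => (A i).continuous.comp continuous_subtype_val)
    (by
      rintro ⟨i, z, hz⟩ ⟨j, w, hw⟩
      rw [hmk]
      exact hcompat i j z hz w hw)
  choose S hSf hS using htri
  refine ⟨f, hf, ⋃ i, S i, Set.finite_iUnion hSf, ?_, ?_⟩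
  · intro x
    obtain ⟨z, rfl⟩ := QuotientAddGroup.mk_surjective x
    obtain ⟨i, w, hw, hzw⟩ := hcov z
    have hw' := hw
    rw [hS i] at hw'
    obtain ⟨T, hT, hwT⟩ := Set.mem_iUnion₂.1 hw'
    exact ⟨T, Set.mem_iUnion.2 ⟨i, hT⟩, w, hwT, ((hmk z w).2 hzw).symm⟩
  · intro T hT
    obtain ⟨i, hi⟩ := Set.mem_iUnion.1 hT
    refine ⟨A i, fun z hz => ?_⟩
    have hz' : z ∈ cell i := by
      rw [hS i]
      exact Set.mem_iUnion₂.2 ⟨T, hi, hz⟩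
    exact hfA ⟨i, z, hz'⟩

/-! ### Similarities, change of basis, and reduction to half of the fundamental domain. -/

lemma Triangulable.image {C : Set ℂ} (h : Triangulable C) (φ : ℂ ≃ₗ[ℝ] ℂ) :
    Triangulable (φ '' C) := by
  obtain ⟨S, hS, rfl⟩ := h
  have hinj : Function.Injective φ.toLinearMap.toAffineMap := φ.injective
  refine ⟨(fun T => T.map φ.toLinearMap.toAffineMap hinj) '' S, hS.image _, ?_⟩
  rw [Set.image_iUnion₂, Set.biUnion_image]
  refine Set.iUnion₂_congr fun T _ => ?_
  rw [triHull, triHull, Affine.Simplex.map_points, Set.range_comp]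
  exact AffineMap.image_convexHull φ.toLinearMap.toAffineMap _

/-- Precompose each piece with the inverse similarity and dilate space by `k`: the two factors
cancel, so the pieces stay isometric, and a dilation creates no new coincidences. -/
lemma Foldable.map {Λ : AddSubgroup ℂ} (h : Foldable Λ) (φ : ℂ ≃ₗ[ℝ] ℂ) {k : ℝ} (hk : 0 < k)
    (hφ : ∀ z, ‖φ z‖ = k * ‖z‖) : Foldable (Λ.map (φ : ℂ →+ ℂ)) := by
  obtain ⟨ι, hι, cell, A, htri, hcov, hcompat⟩ := h
  refine ⟨ι, hι, fun i => φ '' cell i, fun i =>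
    ⟨(k • (A i).toAffineMap).comp φ.symm.toLinearMap.toAffineMap, ?_⟩, fun i => (htri i).image φ,
    ?_, ?_⟩
  · intro v
    have h1 : ‖(A i).linear (φ.symm v)‖ = ‖φ.symm v‖ := (A i).norm_map _
    have h2 := hφ (φ.symm v)
    simp only [AffineMap.comp_linear, AffineMap.smul_linear, LinearMap.toAffineMap_linear,
      LinearMap.comp_apply, LinearMap.smul_apply, norm_smul, LinearEquiv.coe_coe]
    rw [h1, Real.norm_of_nonneg hk.le, ← h2, LinearEquiv.apply_symm_apply]
  · intro z
    obtain ⟨i, w, hw, hzw⟩ := hcov (φ.symm z)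
    refine ⟨i, φ w, Set.mem_image_of_mem _ hw, AddSubgroup.mem_map.2 ⟨_, hzw, ?_⟩⟩
    simp
  · rintro i j _ ⟨z, hz, rfl⟩ _ ⟨w, hw, rfl⟩
    have hinj : φ z - φ w ∈ Λ.map (φ : ℂ →+ ℂ) ↔ z - w ∈ Λ := by
      rw [← map_sub]
      exact AddSubgroup.mem_map_iff_mem (f := (φ : ℂ →+ ℂ)) φ.injective
    rw [hinj, hcompat i j z hz w hw]
    change _ ↔ k • A i (φ.symm (φ z)) = k • A j (φ.symm (φ w))
    rw [smul_right_inj hk.ne', LinearEquiv.symm_apply_apply, LinearEquiv.symm_apply_apply]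

lemma mem_periodLattice {ω₁ ω₂ z : ℂ} :
    z ∈ periodLattice ω₁ ω₂ ↔ ∃ m n : ℤ, m * ω₁ + n * ω₂ = z := by
  simp [periodLattice, AddSubgroup.mem_closure_pair]

lemma Foldable.of_similarity {ω₁ ω₂ η₁ η₂ : ℂ} (h : Foldable (periodLattice η₁ η₂))
    (φ : ℂ ≃ₗ[ℝ] ℂ) {k : ℝ} (hk : 0 < k) (hφ : ∀ z, ‖φ z‖ = k * ‖z‖)
    (h₁ : φ η₁ ∈ periodLattice ω₁ ω₂) (h₂ : φ η₂ ∈ periodLattice ω₁ ω₂)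
    (h₃ : ω₁ ∈ periodLattice (φ η₁) (φ η₂)) (h₄ : ω₂ ∈ periodLattice (φ η₁) (φ η₂)) :
    Foldable (periodLattice ω₁ ω₂) := by
  have heq : (periodLattice η₁ η₂).map (φ : ℂ →+ ℂ) = periodLattice (φ η₁) (φ η₂) := by
    rw [periodLattice, AddMonoidHom.map_closure, Set.image_pair]
    rfl
  have := h.map φ hk hφ
  rw [heq] at this
  convert this using 1
  apply le_antisymm
  · rw [periodLattice, AddSubgroup.closure_le]
    rintro z (rfl | rfl)
    exacts [h₃, h₄]
  · conv_lhs => rw [periodLattice]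
    rw [AddSubgroup.closure_le]
    rintro z (rfl | rfl)
    exacts [h₁, h₂]

lemma t2Space_flatTorus {ω₁ ω₂ : ℂ} (h₁ : ω₁ ≠ 0) (h : (ω₂ / ω₁).im ≠ 0) :
    T2Space (FlatTorus ω₁ ω₂) := by
  have hli : LinearIndependent ℝ ![ω₁, ω₂] := by
    rw [LinearIndependent.pair_iff]
    intro s t hst
    have h3 : (s : ℂ) + t * (ω₂ / ω₁) = 0 := by
      field_simp
      simpa using hst
    have ht : t = 0 := by
      have := congrArg Complex.im h3
      simpa [h] using this
    subst ht
    simpa using h3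
  have hcl : IsClosed (periodLattice ω₁ ω₂ : Set ℂ) := by
    let b := basisOfLinearIndependentOfCardEqFinrank hli (by simp)
    have hb : ⇑b = ![ω₁, ω₂] := coe_basisOfLinearIndependentOfCardEqFinrank _ _
    have hd : DiscreteTopology (Submodule.span ℤ (Set.range b)).toAddSubgroup :=
      inferInstanceAs (DiscreteTopology (Submodule.span ℤ (Set.range b)))
    have heq : periodLattice ω₁ ω₂ = (Submodule.span ℤ (Set.range b)).toAddSubgroup := by
      rw [hb, Submodule.span_int_eq_addSubgroupClosure, periodLattice, Matrix.range_cons_cons_empty]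
    rw [heq]
    exact AddSubgroup.isClosed_of_discrete
  have : IsClosed ((periodLattice ω₁ ω₂ : AddSubgroup ℂ) : Set ℂ) := hcl
  infer_instance

/-- A unimodular change of basis brings the modulus into the fundamental domain, and a reflection
makes its real part nonnegative. -/
lemma foldable_of_fundamental_domain
    (H : ∀ x y : ℝ, 0 ≤ x → x ≤ 1 / 2 → 0 < y → 1 ≤ x ^ 2 + y ^ 2 →
      Foldable (periodLattice 1 (x + y * I)))
    {ω₁ ω₂ : ℂ} (h₁ : ω₁ ≠ 0) (h : 0 < (ω₂ / ω₁).im) : Foldable (periodLattice ω₁ ω₂) := by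
  let z : UpperHalfPlane := ⟨ω₂ / ω₁, h⟩
  obtain ⟨g, hg⟩ := ModularGroup.exists_smul_mem_fd z
  have hdet := g.det_coe
  rw [Matrix.det_fin_two] at hdet
  have hz : ((g • z : UpperHalfPlane) : ℂ) =
      (g 0 0 * (ω₂ / ω₁) + g 0 1) / (g 1 0 * (ω₂ / ω₁) + g 1 1) := by
    rw [UpperHalfPlane.coe_specialLinearGroup_apply]
    simp [z]
  have hd0 : (g 1 0 * (ω₂ / ω₁) + g 1 1 : ℂ) ≠ 0 := by
    intro h0
    rw [h0, div_zero] at hz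
    exact (g • z).ne_zero hz
  generalize g • z = w at hz hg
  obtain ⟨w, hw⟩ := w
  simp only [ModularGroup.fd, Set.mem_ofPred_eq, normSq_apply] at hg
  change 1 ≤ w.re * w.re + w.im * w.im ∧ |w.re| ≤ 1 / 2 at hg
  change w = _ at hz
  generalize g 0 0 = a at *
  generalize g 0 1 = b at *
  generalize g 1 0 = c at *
  generalize g 1 1 = d at *
  have hdet' : (a * d - b * c : ℂ) = 1 := by exact_mod_cast hdet
  -- The new basis of the lattice is `k, k * w`; since the determinant is `1`, `e₁` and `e₂` recover
  -- the old one.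
  set k : ℂ := c * ω₂ + d * ω₁ with hk
  have hk0 : k ≠ 0 := by
    have : k = ω₁ * (c * (ω₂ / ω₁) + d) := by rw [hk]; field_simp
    rw [this]
    exact mul_ne_zero h₁ hd0
  have hkw : k * w = a * ω₂ + b * ω₁ := by
    have : (c * (ω₂ / ω₁) + d : ℂ) = k / ω₁ := by rw [hk]; field_simp
    rw [hz, this]
    field_simp
  have e₁ : (a : ℂ) * k - c * (k * w) = ω₁ := by
    rw [hkw, hk]; linear_combination ω₁ * hdet'
  have e₂ : (d : ℂ) * (k * w) - b * k = ω₂ := by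
    rw [hkw, hk]; linear_combination ω₂ * hdet'
  have hnk : 0 < ‖k‖ := norm_pos_iff.2 hk0
  have hwri : w = w.re + w.im * I := (re_add_im w).symm
  rcases le_total 0 w.re with h0 | h0
  · have hF := H w.re w.im h0 (by rw [← abs_of_nonneg h0]; exact hg.2) hw (by nlinarith [hg.1])
    rw [← hwri] at hF
    refine hF.of_similarity (LinearEquiv.smulOfNeZero ℂ ℂ k hk0 |>.restrictScalars ℝ) hnk
      (fun v => by simp) ?_ ?_ ?_ ?_ <;>
      simp only [LinearEquiv.restrictScalars_apply, LinearEquiv.smulOfNeZero_apply, smul_eq_mul,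
        mul_one, mem_periodLattice]
    · exact ⟨d, c, by rw [hk]; ring⟩
    · exact ⟨b, a, by rw [hkw]; ring⟩
    · exact ⟨a, -c, by rw [← e₁]; push_cast; ring⟩
    · exact ⟨-b, d, by rw [← e₂]; push_cast; ring⟩
  -- Conjugation followed by multiplication by `-k` sends the basis `1, -conj w` to `-k, k * w`.
  · have hF := H (-w.re) w.im (by linarith) (by rw [← abs_of_nonpos h0]; exact hg.2) hw
      (by nlinarith [hg.1])
    have hconj : (starRingEnd ℂ) (((-w.re : ℝ) : ℂ) + w.im * I) = -w := by
      apply Complex.ext <;> simp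
    refine hF.of_similarity (conjAe.toLinearEquiv.trans
      (LinearEquiv.smulOfNeZero ℂ ℂ (-k) (neg_ne_zero.2 hk0) |>.restrictScalars ℝ)) hnk
      (fun v => by simp) ?_ ?_ ?_ ?_ <;>
      simp only [LinearEquiv.restrictScalars_apply, LinearEquiv.smulOfNeZero_apply, smul_eq_mul,
        mul_one, mem_periodLattice, LinearEquiv.trans_apply, AlgEquiv.toLinearEquiv_apply,
        conjAe_coe, map_one, hconj]
    · exact ⟨-d, -c, by rw [hk]; push_cast; ring⟩
    · exact ⟨b, a, by rw [neg_mul_neg, hkw]; ring⟩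
    · exact ⟨-a, -c, by rw [← e₁]; push_cast; ring⟩
    · exact ⟨b, d, by rw [← e₂]; ring⟩

lemma periodLattice_neg_right (ω₁ ω₂ : ℂ) : periodLattice ω₁ (-ω₂) = periodLattice ω₁ ω₂ := by
  ext z
  simp only [mem_periodLattice]
  constructor <;> rintro ⟨m, n, rfl⟩ <;> exact ⟨m, -n, by push_cast; ring⟩

/-- It suffices to fold the flat tori whose modulus lies in half of the fundamental domain. -/
theorem exists_isOrigamiEmbedding_of_fundamental_domain
    (H : ∀ x y : ℝ, 0 ≤ x → x ≤ 1 / 2 → 0 < y → 1 ≤ x ^ 2 + y ^ 2 →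
      Foldable (periodLattice 1 (x + y * I)))
    {ω₁ ω₂ : ℂ} (h₁ : ω₁ ≠ 0) (h : (ω₂ / ω₁).im ≠ 0) :
    ∃ f : FlatTorus ω₁ ω₂ → EuclideanSpace ℝ (Fin 3), IsOrigamiEmbedding f := by
  have := t2Space_flatTorus h₁ h
  apply exists_isOrigamiEmbedding_of_foldable
  rcases lt_or_gt_of_ne h with h | h
  · rw [← periodLattice_neg_right]
    exact foldable_of_fundamental_domain H h₁ (by rw [neg_div, neg_im]; linarith)
  · exact foldable_of_fundamental_domain H h₁ h

/-! ### Horizontal sections of a strip. -/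

/-- The point of the unit circle at angle `x`. -/
noncomputable def cis (x : ℝ) : ℂ := exp (x * I)

lemma cis_add (x y : ℝ) : cis (x + y) = cis x * cis y := by
  simp [cis, add_mul, exp_add]

@[simp] lemma cis_re (x : ℝ) : (cis x).re = Real.cos x := exp_ofReal_mul_I_re x

@[simp] lemma cis_im (x : ℝ) : (cis x).im = Real.sin x := exp_ofReal_mul_I_im x

@[simp] lemma norm_cis (x : ℝ) : ‖cis x‖ = 1 := norm_exp_ofReal_mul_I x

lemma cis_add_int_mul_two_pi (x : ℝ) (k : ℤ) : cis (x + 2 * Real.pi * k) = cis x := by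
  apply Complex.ext
  · rw [cis_re, cis_re, mul_comm, Real.cos_add_int_mul_two_pi]
  · rw [cis_im, cis_im, mul_comm, Real.sin_add_int_mul_two_pi]

lemma im_cis_neg_mul (ψ x : ℝ) : (cis (-ψ) * cis x).im = Real.sin (x - ψ) := by
  rw [← cis_add, cis_im]; ring_nf

lemma re_cis_neg_mul (ψ x : ℝ) : (cis (-ψ) * cis x).re = Real.cos (x - ψ) := by
  rw [← cis_add, cis_re]; ring_nf

lemma cis_sub_cis (a b : ℝ) :
    cis a - cis b = (2 * Real.sin ((a - b) / 2) : ℝ) * (I * cis ((a + b) / 2)) := by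
  apply Complex.ext
  · rw [sub_re, cis_re, cis_re, Real.cos_sub_cos, re_ofReal_mul, mul_re]
    simp; ring
  · rw [sub_im, cis_im, cis_im, Real.sin_sub_sin, im_ofReal_mul, mul_im]
    simp

/-- The corner with index `c` of the horizontal section at relative height `t` of a strip: the
strip joins the polygon with vertices `cis (2 * δ * k)` to its copy turned by `β + δ`. -/
noncomputable def stripCorner (δ β t : ℝ) (c : ℤ) : ℂ :=
  (1 - t : ℝ) * cis (2 * δ * ((c + 1) / 2 : ℤ)) + (t : ℝ) * cis (β + δ + 2 * δ * (c / 2 : ℤ))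

/-- The position of a corner along the section, in units of the edge length of the polygon. -/
noncomputable def cornerPos (t : ℝ) (c : ℤ) : ℝ :=
  (1 - t) * ((c + 1) / 2 : ℤ) + t * (c / 2 : ℤ)

/-- The point dividing the edge from corner `e` to corner `e + 1` in the ratio `r : 1 - r`. -/
noncomputable def stripPoint (δ β t : ℝ) (e : ℤ) (r : ℝ) : ℂ :=
  (1 - r : ℝ) * stripCorner δ β t e + (r : ℝ) * stripCorner δ β t (e + 1)

/-- The position of `stripPoint` along the section. -/
noncomputable def stripPos (t : ℝ) (e : ℤ) (r : ℝ) : ℝ :=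
  (1 - r) * cornerPos t e + r * cornerPos t (e + 1)

lemma cornerPos_le_succ {t : ℝ} (h0 : 0 ≤ t) (h1 : t ≤ 1) (c : ℤ) :
    cornerPos t c ≤ cornerPos t (c + 1) := by
  unfold cornerPos
  have a : ((c + 1) / 2 : ℤ) ≤ (c + 1 + 1) / 2 := by omega
  have b : (c / 2 : ℤ) ≤ (c + 1) / 2 := by omega
  have a' : (((c + 1) / 2 : ℤ) : ℝ) ≤ ((c + 1 + 1) / 2 : ℤ) := by exact_mod_cast a
  have b' : ((c / 2 : ℤ) : ℝ) ≤ ((c + 1) / 2 : ℤ) := by exact_mod_cast b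
  have := mul_le_mul_of_nonneg_left a' (sub_nonneg.2 h1)
  have := mul_le_mul_of_nonneg_left b' h0
  linarith

/-- From one corner to the next, exactly one of the two polygons advances by a vertex: the lower one
at even `c`, the upper one at odd `c`. An edge of the section is thus a polygon edge scaled by `1 -
t` or `t`. -/
lemma stripCorner_succ (δ β t : ℝ) (c : ℤ) : ∃ w : ℂ, ‖w‖ = |2 * Real.sin δ| ∧
    stripCorner δ β t (c + 1) - stripCorner δ β t c =
      ((cornerPos t (c + 1) - cornerPos t c : ℝ) : ℂ) * w := by
  unfold stripCorner cornerPos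
  obtain ⟨k, rfl | rfl⟩ := Int.even_or_odd' c
  · have e1 : (2 * k + 1 + 1) / 2 = k + 1 := by omega
    have e2 : (2 * k + 1) / 2 = k := by omega
    have e3 : (2 * k) / 2 = k := by omega
    rw [e1, e2, e3]
    refine ⟨(2 * Real.sin δ : ℝ) * (I * cis (2 * δ * k + δ)), ?_, ?_⟩
    · rw [norm_mul, norm_mul, norm_I, norm_cis, norm_real, one_mul, mul_one, Real.norm_eq_abs]
    · have := cis_sub_cis (2 * δ * (k + 1 : ℤ)) (2 * δ * k)
      rw [Int.cast_add, Int.cast_one, show (2 * δ * ((k : ℝ) + 1) - 2 * δ * k) / 2 = δ by ring,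
        show (2 * δ * ((k : ℝ) + 1) + 2 * δ * k) / 2 = 2 * δ * k + δ by ring] at this
      push_cast at this ⊢
      linear_combination (1 - t : ℂ) * this
  · have e1 : (2 * k + 1 + 1 + 1) / 2 = k + 1 := by omega
    have e2 : (2 * k + 1) / 2 = k := by omega
    have e3 : (2 * k + 1 + 1) / 2 = k + 1 := by omega
    rw [e1, e2, e3]
    refine ⟨(2 * Real.sin δ : ℝ) * (I * cis (β + 2 * δ + 2 * δ * k)), ?_, ?_⟩
    · rw [norm_mul, norm_mul, norm_I, norm_cis, norm_real, one_mul, mul_one, Real.norm_eq_abs]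
    · have := cis_sub_cis (β + δ + 2 * δ * (k + 1 : ℤ)) (β + δ + 2 * δ * k)
      rw [Int.cast_add, Int.cast_one, show (β + δ + 2 * δ * ((k : ℝ) + 1) - (β + δ + 2 * δ * k)) / 2 = δ by ring,
        show (β + δ + 2 * δ * ((k : ℝ) + 1) + (β + δ + 2 * δ * k)) / 2 = β + 2 * δ + 2 * δ * k by
          ring] at this
      push_cast at this ⊢
      linear_combination (t : ℂ) * this

lemma norm_stripCorner_sub_le {δ β t : ℝ} (h0 : 0 ≤ t) (h1 : t ≤ 1) {a b : ℤ} (hab : a ≤ b) :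
    ‖stripCorner δ β t b - stripCorner δ β t a‖ ≤
      |2 * Real.sin δ| * (cornerPos t b - cornerPos t a) := by
  induction b, hab using Int.leInduction with
  | base => simp
  | succ b _ ih =>
    obtain ⟨w, hw, h⟩ := stripCorner_succ δ β t b
    have h2 : ‖stripCorner δ β t (b + 1) - stripCorner δ β t b‖ =
        |2 * Real.sin δ| * (cornerPos t (b + 1) - cornerPos t b) := by
      rw [h, norm_mul, norm_real, hw, Real.norm_of_nonneg
        (sub_nonneg.2 (cornerPos_le_succ h0 h1 b)), mul_comm]
    calc _ ≤ _ := norm_sub_le_norm_sub_add_norm_sub _ (stripCorner δ β t b) _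
      _ ≤ _ := by rw [h2]; linarith

lemma stripPoint_sub_stripPoint (δ β t : ℝ) (e : ℤ) (r : ℝ) : ∃ w : ℂ,
    ‖w‖ = |2 * Real.sin δ| ∧ ∀ r', stripPoint δ β t e r - stripPoint δ β t e r' =
      ((stripPos t e r - stripPos t e r' : ℝ) : ℂ) * w := by
  obtain ⟨w, hw, h⟩ := stripCorner_succ δ β t e
  refine ⟨w, hw, fun r' => ?_⟩
  simp only [stripPoint, stripPos]
  push_cast at h ⊢
  linear_combination (r - r' : ℂ) * h

@[simp] lemma stripPoint_zero (δ β t : ℝ) (e : ℤ) :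
    stripPoint δ β t e 0 = stripCorner δ β t e := by simp [stripPoint]

@[simp] lemma stripPoint_one (δ β t : ℝ) (e : ℤ) :
    stripPoint δ β t e 1 = stripCorner δ β t (e + 1) := by simp [stripPoint]

@[simp] lemma stripPos_zero (t : ℝ) (e : ℤ) : stripPos t e 0 = cornerPos t e := by
  simp [stripPos]

@[simp] lemma stripPos_one (t : ℝ) (e : ℤ) : stripPos t e 1 = cornerPos t (e + 1) := by
  simp [stripPos]

lemma stripPos_mono {t : ℝ} (h0 : 0 ≤ t) (h1 : t ≤ 1) (e : ℤ) {r r' : ℝ} (h : r ≤ r') :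
    stripPos t e r ≤ stripPos t e r' := by
  have := mul_le_mul_of_nonneg_left h (sub_nonneg.2 (cornerPos_le_succ h0 h1 e))
  simp only [stripPos]
  linarith

lemma norm_stripPoint_sub_le {δ β t : ℝ} (h0 : 0 ≤ t) (h1 : t ≤ 1) {a b : ℤ} (hab : a < b)
    {r r' : ℝ} (hr : r ≤ 1) (hr' : 0 ≤ r') :
    ‖stripPoint δ β t b r' - stripPoint δ β t a r‖ ≤
      |2 * Real.sin δ| * (stripPos t b r' - stripPos t a r) := by
  obtain ⟨w, hw, h⟩ := stripPoint_sub_stripPoint δ β t b r'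
  obtain ⟨w', hw', h'⟩ := stripPoint_sub_stripPoint δ β t a 1
  have e1 := norm_stripCorner_sub_le (δ := δ) (β := β) h0 h1 (show a + 1 ≤ b by omega)
  have e2 := congrArg norm (h 0)
  have e3 := congrArg norm (h' r)
  rw [norm_mul, norm_real, hw, Real.norm_of_nonneg
    (sub_nonneg.2 (stripPos_mono h0 h1 b hr'))] at e2
  rw [norm_mul, norm_real, hw', Real.norm_of_nonneg
    (sub_nonneg.2 (stripPos_mono h0 h1 a hr))] at e3
  simp only [stripPoint_zero, stripPoint_one, stripPos_zero, stripPos_one] at e2 e3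
  calc _ = ‖(stripPoint δ β t b r' - stripCorner δ β t b) +
        (stripCorner δ β t b - stripCorner δ β t (a + 1)) +
        (stripCorner δ β t (a + 1) - stripPoint δ β t a r)‖ := by congr 1; ring
    _ ≤ _ := norm_add₃_le
    _ ≤ _ := by rw [e2, e3]; linarith

/-- A chord is at most as long as the arc it spans. This covers both the corners shared by
consecutive edges and the edges that collapse at `t = 0` or `t = 1`. -/
lemma stripPoint_eq_of_stripPos_eq {δ β t : ℝ} (h0 : 0 ≤ t) (h1 : t ≤ 1) {e e' : ℤ} {r r' : ℝ}
    (hr : r ∈ Icc (0 : ℝ) 1) (hr' : r' ∈ Icc (0 : ℝ) 1) (h : stripPos t e r = stripPos t e' r') :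
    stripPoint δ β t e r = stripPoint δ β t e' r' := by
  rcases lt_trichotomy e e' with he | rfl | he
  · have := norm_stripPoint_sub_le (δ := δ) (β := β) h0 h1 he hr.2 hr'.1
    rw [h, sub_self, mul_zero] at this
    exact (sub_eq_zero.1 (norm_le_zero_iff.1 this)).symm
  · obtain ⟨w, -, hw⟩ := stripPoint_sub_stripPoint δ β t e r
    have := hw r'
    rwa [h, sub_self, ofReal_zero, zero_mul, sub_eq_zero] at this
  · have := norm_stripPoint_sub_le (δ := δ) (β := β) h0 h1 he hr'.2 hr.1
    rw [h, sub_self, mul_zero] at this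
    exact sub_eq_zero.1 (norm_le_zero_iff.1 this)

/-! ### Closing up of the sections after `2 * n` corners. -/

section Periodicity

variable {n : ℕ} {δ : ℝ}

lemma stripCorner_add_period (hδ : n * δ = Real.pi) (β t : ℝ) (c l : ℤ) :
    stripCorner δ β t (c + 2 * n * l) = stripCorner δ β t c := by
  have e1 : (c + 2 * n * l + 1) / 2 = (c + 1) / 2 + n * l := by
    rw [show c + 2 * n * l + 1 = (c + 1) + 2 * (n * l) by ring]; omega
  have e2 : (c + 2 * n * l) / 2 = c / 2 + n * l := by
    rw [show c + 2 * n * l = c + 2 * (n * l) by ring]; omega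
  rw [stripCorner, stripCorner, e1, e2]
  push_cast
  rw [show 2 * δ * (((c + 1) / 2 : ℤ) + n * l) = 2 * δ * ((c + 1) / 2 : ℤ) + 2 * Real.pi * l by
    rw [← hδ]; ring, show β + δ + 2 * δ * ((c / 2 : ℤ) + n * l) =
    β + δ + 2 * δ * (c / 2 : ℤ) + 2 * Real.pi * l by rw [← hδ]; ring,
    cis_add_int_mul_two_pi, cis_add_int_mul_two_pi]

lemma cornerPos_add_period (n : ℕ) (t : ℝ) (c l : ℤ) :
    cornerPos t (c + 2 * n * l) = cornerPos t c + n * l := by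
  have e1 : (c + 2 * n * l + 1) / 2 = (c + 1) / 2 + n * l := by
    rw [show c + 2 * n * l + 1 = (c + 1) + 2 * (n * l) by ring]; omega
  have e2 : (c + 2 * n * l) / 2 = c / 2 + n * l := by
    rw [show c + 2 * n * l = c + 2 * (n * l) by ring]; omega
  rw [cornerPos, cornerPos, e1, e2]
  push_cast
  ring

lemma stripPoint_add_period (hδ : n * δ = Real.pi) (β t : ℝ) (c l : ℤ) (r : ℝ) :
    stripPoint δ β t (c + 2 * n * l) r = stripPoint δ β t c r := by
  rw [stripPoint, stripPoint, add_right_comm, stripCorner_add_period hδ,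
    stripCorner_add_period hδ]

lemma stripPos_add_period (n : ℕ) (t : ℝ) (c l : ℤ) (r : ℝ) :
    stripPos t (c + 2 * n * l) r = stripPos t c r + n * l := by
  rw [stripPos, stripPos, add_right_comm, cornerPos_add_period, cornerPos_add_period]
  ring

lemma stripPos_surjective {n : ℕ} (hn : 0 < n) {t : ℝ} (h0 : 0 ≤ t) (x : ℝ) :
    ∃ (e : Fin (2 * n)) (r : ℝ) (l : ℤ), r ∈ Icc (0 : ℝ) 1 ∧
      x = stripPos t ((e : ℕ) : ℤ) r + n * l := by
  have hstep : ∃ (e : ℤ) (r : ℝ), r ∈ Icc (0 : ℝ) 1 ∧ x = stripPos t e r := by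
    have hf0 := Int.fract_nonneg x
    have hf1 := Int.fract_lt_one x
    have hx := Int.floor_add_fract x
    have a1 : (2 * ⌊x⌋ + 1 + 1 + 1) / 2 = ⌊x⌋ + 1 := by omega
    have a2 : (2 * ⌊x⌋ + 1) / 2 = ⌊x⌋ := by omega
    have a3 : (2 * ⌊x⌋ + 1 + 1) / 2 = ⌊x⌋ + 1 := by omega
    have a4 : (2 * ⌊x⌋) / 2 = ⌊x⌋ := by omega
    -- Each unit of position consists of an even edge of length `1 - t` followed by an odd edge of
    -- length `t`.
    rcases le_or_gt (1 - t) (Int.fract x) with h | h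
    · have ht : 0 < t := by linarith
      refine ⟨2 * ⌊x⌋ + 1, (Int.fract x - (1 - t)) / t, ⟨div_nonneg (by linarith) h0,
        (div_le_one ht).2 (by linarith)⟩, ?_⟩
      simp only [stripPos, cornerPos, a1, a2, a3]
      push_cast
      field_simp
      linear_combination -t * hx
    · have ht : 0 < 1 - t := by linarith
      refine ⟨2 * ⌊x⌋, Int.fract x / (1 - t), ⟨div_nonneg hf0 ht.le,
        (div_le_one ht).2 h.le⟩, ?_⟩
      simp only [stripPos, cornerPos, a4, a2, a3]
      push_cast
      field_simp
      linear_combination -(1 - t) * hx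
  obtain ⟨e, r, hr, rfl⟩ := hstep
  have hn' : (0 : ℤ) < 2 * n := by omega
  have m0 := Int.emod_nonneg e hn'.ne'
  have m1 := Int.emod_lt_of_pos e hn'
  refine ⟨⟨(e % (2 * n)).toNat, by omega⟩, r, e / (2 * n), hr, ?_⟩
  rw [← stripPos_add_period]
  congr 1
  simp only [Int.toNat_of_nonneg m0]
  exact (Int.emod_add_mul_ediv e (2 * n)).symm

end Periodicity

/-! ### Simplicity of the sections. -/

section Embedded

variable {n : ℕ} {δ β t : ℝ}

lemma im_cis_neg_mul_stripCorner_sub (ψ : ℝ) (c c' : ℤ) :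
    (cis (-ψ) * (stripCorner δ β t c - stripCorner δ β t c')).im =
      (1 - t) * (2 * Real.sin (δ * ((c + 1) / 2 - (c' + 1) / 2 : ℤ)) *
        Real.cos (δ * ((c + 1) / 2 + (c' + 1) / 2 : ℤ) - ψ)) +
      t * (2 * Real.sin (δ * (c / 2 - c' / 2 : ℤ)) *
        Real.cos (β + δ + δ * (c / 2 + c' / 2 : ℤ) - ψ)) := by
  have key : ∀ a b : ℝ, (cis (-ψ) * (cis a - cis b)).im =
      2 * Real.sin ((a - b) / 2) * Real.cos ((a + b) / 2 - ψ) := by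
    intro a b
    rw [mul_sub, sub_im, im_cis_neg_mul, im_cis_neg_mul, Real.sin_sub_sin]
    ring_nf
  have e : cis (-ψ) * (stripCorner δ β t c - stripCorner δ β t c') =
      (1 - t : ℝ) * (cis (-ψ) * (cis (2 * δ * ((c + 1) / 2 : ℤ)) -
        cis (2 * δ * ((c' + 1) / 2 : ℤ)))) + (t : ℝ) * (cis (-ψ) *
        (cis (β + δ + 2 * δ * (c / 2 : ℤ)) - cis (β + δ + 2 * δ * (c' / 2 : ℤ)))) := by
    rw [stripCorner, stripCorner]; ring
  rw [e, add_im, im_ofReal_mul, im_ofReal_mul, key, key]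
  push_cast
  ring_nf

lemma sin_mul_int_nonneg (hn : 0 < n) (hδ : n * δ = Real.pi) {m : ℤ} (h0 : 0 ≤ m) (h1 : m ≤ n) :
    0 ≤ Real.sin (δ * m) ∧ (Real.sin (δ * m) = 0 → m = 0 ∨ m = n) := by
  have hn' : (0 : ℝ) < n := by exact_mod_cast hn
  have hδ0 : 0 < δ := pos_of_mul_pos_right (hδ ▸ Real.pi_pos) hn'.le
  have a : (0 : ℝ) ≤ m := by exact_mod_cast h0
  have b : (m : ℝ) ≤ n := by exact_mod_cast h1
  refine ⟨Real.sin_nonneg_of_nonneg_of_le_pi (by positivity) (by rw [← hδ]; nlinarith), ?_⟩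
  intro h
  by_contra! hne
  have a' : (0 : ℝ) < m := by exact_mod_cast lt_of_le_of_ne h0 hne.1.symm
  have b' : (m : ℝ) < n := by exact_mod_cast lt_of_le_of_ne h1 hne.2
  exact (Real.sin_pos_of_pos_of_lt_pi (by positivity) (by rw [← hδ]; nlinarith)).ne' h

/-- By sum-to-product, the component of a difference of corners is a combination of terms `sin *
cos` with weights `1 - t` and `t`. The sines are nonnegative because the vertex indices differ by
between `0` and `n`. The cosines are positive because `hp` and `hq` keep their angles within `δ +
|β| / 2 < π / 2`. -/
lemma stripCorner_sub_halfplane (hn : 4 ≤ n) (hδ : n * δ = Real.pi) (hβ : |β| < Real.pi - 2 * δ)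
    (h0 : 0 ≤ t) (h1 : t ≤ 1) {c c' m : ℤ} (hc0 : c' ≤ c) (hc1 : c ≤ c' + 2 * n)
    (hp : |2 * ((c + 1) / 2 + (c' + 1) / 2) - m| ≤ 2)
    (hq : |2 * (c / 2 + c' / 2) + 2 - m| ≤ 2) :
    0 ≤ (cis (-((δ * m + β) / 2)) * (stripCorner δ β t c - stripCorner δ β t c')).im ∧
    ((cis (-((δ * m + β) / 2)) * (stripCorner δ β t c - stripCorner δ β t c')).im = 0 →
      cornerPos t c - cornerPos t c' = 0 ∨ cornerPos t c - cornerPos t c' = n) := by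
  have hn' : (0 : ℝ) < n := by exact_mod_cast (by omega : 0 < n)
  have hδ0 : 0 < δ := pos_of_mul_pos_right (hδ ▸ Real.pi_pos) hn'.le
  rw [abs_lt] at hβ
  obtain ⟨hp0, hp1⟩ := abs_le.1 hp
  obtain ⟨hq0, hq1⟩ := abs_le.1 hq
  have hp0' : (-2 : ℝ) ≤ 2 * ((c + 1) / 2 + (c' + 1) / 2 : ℤ) - m := by exact_mod_cast hp0
  have hp1' : 2 * ((c + 1) / 2 + (c' + 1) / 2 : ℤ) - m ≤ (2 : ℝ) := by exact_mod_cast hp1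
  have hq0' : (-2 : ℝ) ≤ 2 * (c / 2 + c' / 2 : ℤ) + 2 - m := by exact_mod_cast hq0
  have hq1' : 2 * (c / 2 + c' / 2 : ℤ) + 2 - m ≤ (2 : ℝ) := by exact_mod_cast hq1
  have cp : 0 < Real.cos (δ * ((c + 1) / 2 + (c' + 1) / 2 : ℤ) - (δ * m + β) / 2) := by
    apply Real.cos_pos_of_mem_Ioo
    have a := mul_le_mul_of_nonneg_left hp0' hδ0.le
    have b := mul_le_mul_of_nonneg_left hp1' hδ0.le
    constructor <;> linarith
  have cq : 0 < Real.cos (β + δ + δ * (c / 2 + c' / 2 : ℤ) - (δ * m + β) / 2) := by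
    apply Real.cos_pos_of_mem_Ioo
    have a := mul_le_mul_of_nonneg_left hq0' hδ0.le
    have b := mul_le_mul_of_nonneg_left hq1' hδ0.le
    constructor <;> linarith
  obtain ⟨sp, sp'⟩ := sin_mul_int_nonneg (m := (c + 1) / 2 - (c' + 1) / 2) (by omega) hδ
    (by omega) (by omega)
  obtain ⟨sq, sq'⟩ := sin_mul_int_nonneg (m := c / 2 - c' / 2) (by omega) hδ
    (by omega) (by omega)
  rw [im_cis_neg_mul_stripCorner_sub]
  have A := mul_nonneg (sub_nonneg.2 h1) (mul_nonneg (mul_nonneg zero_le_two sp) cp.le)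
  have B := mul_nonneg h0 (mul_nonneg (mul_nonneg zero_le_two sq) cq.le)
  refine ⟨add_nonneg A B, fun h => ?_⟩
  have hA : (1 - t) = 0 ∨ Real.sin (δ * ((c + 1) / 2 - (c' + 1) / 2 : ℤ)) = 0 := by
    have := le_antisymm (by linarith) A
    exact (mul_eq_zero.1 this).imp_right fun h =>
      (mul_eq_zero.1 ((mul_eq_zero.1 h).resolve_right cp.ne')).resolve_left two_ne_zero
  have hB : t = 0 ∨ Real.sin (δ * (c / 2 - c' / 2 : ℤ)) = 0 := by
    have := le_antisymm (by linarith) B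
    exact (mul_eq_zero.1 this).imp_right fun h =>
      (mul_eq_zero.1 ((mul_eq_zero.1 h).resolve_right cq.ne')).resolve_left two_ne_zero
  have hdiff : cornerPos t c - cornerPos t c' = (1 - t) * ((c + 1) / 2 - (c' + 1) / 2 : ℤ) +
      t * (c / 2 - c' / 2 : ℤ) := by
    rw [cornerPos, cornerPos]; push_cast; ring
  rw [hdiff]
  rcases hA with hA | hA
  · rcases hB with hB | hB
    · linarith
    · rw [hA, show t = 1 by linarith]
      rcases sq' hB with h | h <;> rw [h] <;> simp
  · rcases hB with hB | hB
    · rw [hB]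
      rcases sp' hA with h | h <;> rw [h] <;> simp
    · rcases sp' hA with h | h <;> rcases sq' hB with h' | h'
      · rw [h, h']; simp
      · omega
      · omega
      · rw [h, h', Int.cast_natCast]; right; ring

/-- Positions grow like half the index, which later decides between the differences `0` and `n`. -/
lemma abs_two_mul_cornerPos_sub_le (h0 : 0 ≤ t) (h1 : t ≤ 1) (c c' : ℤ) :
    |2 * (cornerPos t c - cornerPos t c') - (c - c')| ≤ 1 := by
  have a0 : (-1 : ℝ) ≤ 2 * ((c + 1) / 2 - (c' + 1) / 2 : ℤ) - (c - c' : ℤ) := by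
    exact_mod_cast (by omega : (-1 : ℤ) ≤ 2 * ((c + 1) / 2 - (c' + 1) / 2) - (c - c'))
  have a1 : 2 * ((c + 1) / 2 - (c' + 1) / 2 : ℤ) - (c - c' : ℤ) ≤ (1 : ℝ) := by
    exact_mod_cast (by omega : 2 * ((c + 1) / 2 - (c' + 1) / 2) - (c - c') ≤ 1)
  have b0 : (-1 : ℝ) ≤ 2 * (c / 2 - c' / 2 : ℤ) - (c - c' : ℤ) := by
    exact_mod_cast (by omega : (-1 : ℤ) ≤ 2 * (c / 2 - c' / 2) - (c - c'))
  have b1 : 2 * (c / 2 - c' / 2 : ℤ) - (c - c' : ℤ) ≤ (1 : ℝ) := by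
    exact_mod_cast (by omega : 2 * (c / 2 - c' / 2) - (c - c') ≤ 1)
  rw [cornerPos, cornerPos, abs_le]
  push_cast at a0 a1 b0 b1
  constructor <;> nlinarith

lemma stripPos_sub_eq_of_stripPoint_eq_of_lt (hn : 4 ≤ n) (hδ : n * δ = Real.pi)
    (hβ : |β| < Real.pi - 2 * δ) (h0 : 0 ≤ t) (h1 : t ≤ 1) {e e' : ℤ} {r r' : ℝ}
    (hr : r ∈ Icc (0 : ℝ) 1) (hr' : r' ∈ Icc (0 : ℝ) 1) (he : e' < e) (he' : e < e' + 2 * n)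
    (h : stripPoint δ β t e r = stripPoint δ β t e' r') :
    stripPos t e r - stripPos t e' r' = 0 ∨ stripPos t e r - stripPos t e' r' = n := by
  have hn' : (4 : ℝ) ≤ n := by exact_mod_cast hn
  -- This direction lies midway between the two edges, so one half-plane serves all four pairs of
  -- their endpoints.
  set v := cis (-((δ * (e + e' + 2 : ℤ) + β) / 2)) with hv
  have hpair : ∀ i j : ℤ, (i = 0 ∨ i = 1) → (j = 0 ∨ j = 1) →
      0 ≤ (v * (stripCorner δ β t (e + i) - stripCorner δ β t (e' + j))).im ∧
      ((v * (stripCorner δ β t (e + i) - stripCorner δ β t (e' + j))).im = 0 →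
        cornerPos t (e + i) - cornerPos t (e' + j) = 0 ∨
        cornerPos t (e + i) - cornerPos t (e' + j) = n) := by
    intro i j hi hj
    apply stripCorner_sub_halfplane hn hδ hβ h0 h1
    · omega
    · omega
    · rw [abs_le]; omega
    · rw [abs_le]; omega
  have hsum : (1 - r) * (1 - r') * (v * (stripCorner δ β t (e + 0) -
        stripCorner δ β t (e' + 0))).im +
      (1 - r) * r' * (v * (stripCorner δ β t (e + 0) - stripCorner δ β t (e' + 1))).im +
      r * (1 - r') * (v * (stripCorner δ β t (e + 1) - stripCorner δ β t (e' + 0))).im +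
      r * r' * (v * (stripCorner δ β t (e + 1) - stripCorner δ β t (e' + 1))).im = 0 := by
    have : (v * (stripPoint δ β t e r - stripPoint δ β t e' r')).im = 0 := by rw [h]; simp
    rw [← this]
    simp only [← im_ofReal_mul, ← add_im]
    congr 1
    rw [stripPoint, stripPoint, add_zero, add_zero]
    push_cast
    ring
  have R := sub_nonneg.2 hr.2
  have R' := sub_nonneg.2 hr'.2
  have p00 := hpair 0 0 (by simp) (by simp)
  have p01 := hpair 0 1 (by simp) (by simp)
  have p10 := hpair 1 0 (by simp) (by simp)
  have p11 := hpair 1 1 (by simp) (by simp)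
  have q00 := mul_nonneg (mul_nonneg R R') p00.1
  have q01 := mul_nonneg (mul_nonneg R hr'.1) p01.1
  have q10 := mul_nonneg (mul_nonneg hr.1 R') p10.1
  have q11 := mul_nonneg (mul_nonneg hr.1 hr'.1) p11.1
  have z00 := le_antisymm (by linarith) q00
  have z01 := le_antisymm (by linarith) q01
  have z10 := le_antisymm (by linarith) q10
  have z11 := le_antisymm (by linarith) q11
  have w00 := (mul_eq_zero.1 z00).imp_right p00.2
  have w01 := (mul_eq_zero.1 z01).imp_right p01.2
  have w10 := (mul_eq_zero.1 z10).imp_right p10.2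
  have w11 := (mul_eq_zero.1 z11).imp_right p11.2
  have b00 := abs_le.1 (abs_two_mul_cornerPos_sub_le h0 h1 (e + 0) (e' + 0))
  have b01 := abs_le.1 (abs_two_mul_cornerPos_sub_le h0 h1 (e + 0) (e' + 1))
  have b10 := abs_le.1 (abs_two_mul_cornerPos_sub_le h0 h1 (e + 1) (e' + 0))
  have b11 := abs_le.1 (abs_two_mul_cornerPos_sub_le h0 h1 (e + 1) (e' + 1))
  push_cast at b00 b01 b10 b11
  have hE : stripPos t e r - stripPos t e' r' =
      (1 - r) * (1 - r') * (cornerPos t (e + 0) - cornerPos t (e' + 0)) +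
      (1 - r) * r' * (cornerPos t (e + 0) - cornerPos t (e' + 1)) +
      r * (1 - r') * (cornerPos t (e + 1) - cornerPos t (e' + 0)) +
      r * r' * (cornerPos t (e + 1) - cornerPos t (e' + 1)) := by
    rw [stripPos, stripPos, add_zero, add_zero]; ring
  -- If `e - e' ≤ n`, every difference of corner positions is at most `n / 2 + 1 < n`; otherwise
  -- every one is positive. So the pairs of nonzero weight all give `0`, or all give `n`.
  rcases le_or_gt e (e' + n) with hs | hs
  · left
    have hs' : (e : ℝ) ≤ e' + n := by exact_mod_cast hs
    have k : ∀ {w D : ℝ}, (w = 0 ∨ D = 0 ∨ D = n) → D < n → w * D = 0 := by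
      rintro w D (h | h | h) hD
      · rw [h, zero_mul]
      · rw [h, mul_zero]
      · exact absurd h hD.ne
    rw [hE, k w00 (by linarith), k w01 (by linarith), k w10 (by linarith), k w11 (by linarith)]
    simp
  · right
    have hs' : (e' : ℝ) + n + 1 ≤ e := by exact_mod_cast hs
    have k : ∀ {w D : ℝ}, (w = 0 ∨ D = 0 ∨ D = n) → 0 < D → w * D = w * n := by
      rintro w D (h | h | h) hD
      · rw [h, zero_mul, zero_mul]
      · exact absurd h hD.ne'
      · rw [h]
    rw [hE, k w00 (by linarith), k w01 (by linarith), k w10 (by linarith), k w11 (by linarith)]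
    ring

/-- The horizontal sections of a strip are simple closed polygons. -/
theorem stripPoint_eq_iff (hn : 4 ≤ n) (hδ : n * δ = Real.pi) (hβ : |β| < Real.pi - 2 * δ)
    (h0 : 0 ≤ t) (h1 : t ≤ 1) {e e' : ℤ} {r r' : ℝ}
    (hr : r ∈ Icc (0 : ℝ) 1) (hr' : r' ∈ Icc (0 : ℝ) 1) :
    stripPoint δ β t e r = stripPoint δ β t e' r' ↔
      ∃ l : ℤ, stripPos t e r - stripPos t e' r' = n * l := by
  have hn' : (4 : ℝ) ≤ n := by exact_mod_cast hn
  have hδ0 : 0 < δ := pos_of_mul_pos_right (hδ ▸ Real.pi_pos) (by linarith)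
  constructor
  · intro h
    have hN : (0 : ℤ) < 2 * n := by omega
    -- Moving `e'` by whole periods leaves `e` on the same edge or ahead by fewer than `2 * n`
    -- edges.
    set l := (e - e') / (2 * n) with hl
    have m0 := Int.emod_nonneg (e - e') hN.ne'
    have m1 := Int.emod_lt_of_pos (e - e') hN
    have m2 := Int.emod_add_mul_ediv (e - e') (2 * n)
    rw [← hl] at m2
    have hP := stripPos_add_period n t e' l r'
    rw [← stripPoint_add_period hδ β t e' l] at h
    rcases eq_or_lt_of_le m0 with hm | hm
    · have he : e = e' + 2 * n * l := by omega
      rw [← he] at h hP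
      obtain ⟨w, hw, hw'⟩ := stripPoint_sub_stripPoint δ β t e r
      have hw0 : w ≠ 0 := by
        have : 0 < Real.sin δ := Real.sin_pos_of_pos_of_lt_pi hδ0 (by rw [← hδ]; nlinarith)
        rw [← norm_pos_iff, hw]
        positivity
      have := hw' r'
      rw [h, sub_self, eq_comm, mul_eq_zero, or_iff_left hw0, ofReal_eq_zero] at this
      exact ⟨l, by linarith⟩
    · rcases stripPos_sub_eq_of_stripPoint_eq_of_lt hn hδ hβ h0 h1 hr hr' (by omega) (by omega) h
        with h | h
      · exact ⟨l, by linarith⟩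
      · exact ⟨l + 1, by push_cast; linarith⟩
  · rintro ⟨l, hl⟩
    rw [← stripPoint_add_period hδ β t e' l]
    apply stripPoint_eq_of_stripPos_eq h0 h1 hr hr'
    rw [stripPos_add_period]
    linarith

end Embedded

/-! ### Separating the outer strip from the inner one. -/

section Separation

variable {n : ℕ} {δ β t : ℝ}

lemma re_cis_neg_mul_stripCorner (ψ : ℝ) (c : ℤ) :
    (cis (-ψ) * stripCorner δ β t c).re =
      (1 - t) * Real.cos (2 * δ * ((c + 1) / 2 : ℤ) - ψ) +
      t * Real.cos (β + δ + 2 * δ * (c / 2 : ℤ) - ψ) := by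
  have e : cis (-ψ) * stripCorner δ β t c =
      (1 - t : ℝ) * (cis (-ψ) * cis (2 * δ * ((c + 1) / 2 : ℤ))) +
      (t : ℝ) * (cis (-ψ) * cis (β + δ + 2 * δ * (c / 2 : ℤ))) := by
    rw [stripCorner]; ring
  rw [e, add_re, re_ofReal_mul, re_ofReal_mul, re_cis_neg_mul, re_cis_neg_mul]

lemma le_re_cis_neg_mul_stripPoint {ψ d : ℝ} {e : ℤ} {r : ℝ} (hr : r ∈ Icc (0 : ℝ) 1)
    (h : d ≤ (cis (-ψ) * stripCorner δ β t e).re)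
    (h' : d ≤ (cis (-ψ) * stripCorner δ β t (e + 1)).re) :
    d ≤ (cis (-ψ) * stripPoint δ β t e r).re := by
  have e : cis (-ψ) * stripPoint δ β t e r = (1 - r : ℝ) * (cis (-ψ) * stripCorner δ β t e) +
      (r : ℝ) * (cis (-ψ) * stripCorner δ β t (e + 1)) := by
    rw [stripPoint]; ring
  rw [e, add_re, re_ofReal_mul, re_ofReal_mul]
  nlinarith [mul_le_mul_of_nonneg_left h (sub_nonneg.2 hr.2), mul_le_mul_of_nonneg_left h' hr.1]

lemma re_cis_neg_mul_stripPoint_lt {ψ d : ℝ} {e : ℤ} {r : ℝ} (hr : r ∈ Icc (0 : ℝ) 1)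
    (h : (cis (-ψ) * stripCorner δ β t e).re < d)
    (h' : (cis (-ψ) * stripCorner δ β t (e + 1)).re < d) :
    (cis (-ψ) * stripPoint δ β t e r).re < d := by
  have e : cis (-ψ) * stripPoint δ β t e r = (1 - r : ℝ) * (cis (-ψ) * stripCorner δ β t e) +
      (r : ℝ) * (cis (-ψ) * stripCorner δ β t (e + 1)) := by
    rw [stripPoint]; ring
  rw [e, add_re, re_ofReal_mul, re_ofReal_mul]
  rcases eq_or_lt_of_le hr.1 with h0 | h0
  · rw [← h0]; linarith
  · nlinarith [mul_le_mul_of_nonneg_left h.le (sub_nonneg.2 hr.2), mul_lt_mul_of_pos_left h' h0]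

/-- Controls the one corner that may leave the plane of a face when passing to the adjacent face. -/
lemma cos_le_cos_neg_add {b : ℝ} (hδ0 : 0 < δ) (hb : δ ≤ b) (hb' : b ≤ Real.pi) :
    Real.cos b ≤ Real.cos (-b + 2 * δ) := by
  rw [← Real.cos_abs (-b + 2 * δ)]
  apply Real.cos_le_cos_of_nonneg_of_le_pi (abs_nonneg _) hb'
  rw [abs_le]; constructor <;> linarith

/-- A strip turning backwards stays beyond the planes through the edges of its lower polygon. -/
lemma lower_le_stripPoint {b : ℝ} (hδ0 : 0 < δ) (hb : δ ≤ b) (hb' : b ≤ Real.pi)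
    (h0 : 0 ≤ t) {e : ℤ} {r : ℝ} (hr : r ∈ Icc (0 : ℝ) 1) :
    (1 - t) * Real.cos δ + t * Real.cos b ≤
      (cis (-((2 * (e / 2 : ℤ) + 1) * δ)) * stripPoint δ (-b) t e r).re := by
  have hcos := mul_le_mul_of_nonneg_left (cos_le_cos_neg_add hδ0 hb hb') h0
  -- The bound describes the plane through the lower edge `k` and the upper vertex `k`. Face `2 * k`
  -- lies in it; on face `2 * k + 1` only the last corner can be off it, and on the far side.
  obtain ⟨k, rfl | rfl⟩ := Int.even_or_odd' e
  · have a1 : (2 * k + 1 + 1) / 2 = k + 1 := by omega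
    have a2 : (2 * k + 1) / 2 = k := by omega
    have a3 : (2 * k) / 2 = k := by omega
    apply le_re_cis_neg_mul_stripPoint hr <;> rw [re_cis_neg_mul_stripCorner]
    · rw [a2, a3, ← Real.cos_neg δ, ← Real.cos_neg b]
      ring_nf; rfl
    · rw [a1, a2, a3, ← Real.cos_neg b]
      push_cast
      ring_nf; rfl
  · have a1 : (2 * k + 1 + 1 + 1) / 2 = k + 1 := by omega
    have a2 : (2 * k + 1) / 2 = k := by omega
    have a3 : (2 * k + 1 + 1) / 2 = k + 1 := by omega
    apply le_re_cis_neg_mul_stripPoint hr <;> rw [re_cis_neg_mul_stripCorner]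
    · rw [a2, a3, ← Real.cos_neg b]
      push_cast
      ring_nf; rfl
    · rw [a1, a2, a3]
      push_cast
      rw [show 2 * δ * ((k : ℝ) + 1) - (2 * k + 1) * δ = δ by ring,
        show -b + δ + 2 * δ * ((k : ℝ) + 1) - (2 * k + 1) * δ = -b + 2 * δ by ring]
      linarith

/-- A strip turning backwards stays beyond the planes through the edges of its upper polygon. -/
lemma upper_le_stripPoint {b : ℝ} (hδ0 : 0 < δ) (hb : δ ≤ b) (hb' : b ≤ Real.pi)
    (h1 : t ≤ 1) {e : ℤ} {r : ℝ} (hr : r ∈ Icc (0 : ℝ) 1) :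
    (1 - t) * Real.cos b + t * Real.cos δ ≤
      (cis (-(-b + δ + (2 * (e / 2 : ℤ) + 1) * δ)) * stripPoint δ (-b) t e r).re := by
  have hcos := mul_le_mul_of_nonneg_left (cos_le_cos_neg_add hδ0 hb hb') (sub_nonneg.2 h1)
  obtain ⟨k, rfl | rfl⟩ := Int.even_or_odd' e
  · have a1 : (2 * k + 1 + 1) / 2 = k + 1 := by omega
    have a2 : (2 * k + 1) / 2 = k := by omega
    have a3 : (2 * k) / 2 = k := by omega
    apply le_re_cis_neg_mul_stripPoint hr <;> rw [re_cis_neg_mul_stripCorner]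
    · rw [a2, a3]
      rw [show 2 * δ * (k : ℝ) - (-b + δ + (2 * k + 1) * δ) = -(-b + 2 * δ) by ring,
        show -b + δ + 2 * δ * (k : ℝ) - (-b + δ + (2 * k + 1) * δ) = -δ by ring, Real.cos_neg,
        Real.cos_neg]
      linarith
    · rw [a1, a2, a3, ← Real.cos_neg δ]
      push_cast
      ring_nf; rfl
  · have a1 : (2 * k + 1 + 1 + 1) / 2 = k + 1 := by omega
    have a2 : (2 * k + 1) / 2 = k := by omega
    have a3 : (2 * k + 1 + 1) / 2 = k + 1 := by omega
    apply le_re_cis_neg_mul_stripPoint hr <;> rw [re_cis_neg_mul_stripCorner]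
    · rw [a2, a3, ← Real.cos_neg δ]
      push_cast
      ring_nf; rfl
    · rw [a1, a2, a3]
      push_cast
      ring_nf; rfl

/-- The polygon lies within the lines through its edges: seen from the normal of an edge, its
vertices are at odd multiples of `δ`, and `cos δ` is the inradius. -/
lemma cos_odd_mul_le (hn : 0 < n) (hδ : n * δ = Real.pi) (m : ℤ) :
    Real.cos ((2 * m + 1) * δ) ≤ Real.cos δ := by
  have hn' : (0 : ℝ) < n := by exact_mod_cast hn
  have hδ0 : 0 < δ := pos_of_mul_pos_right (hδ ▸ Real.pi_pos) hn'.le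
  have hN : (0 : ℤ) < 2 * n := by omega
  set q := (2 * m + 1 + n) / (2 * n) with hq
  have m0 := Int.emod_nonneg (2 * m + 1 + n) hN.ne'
  have m1 := Int.emod_lt_of_pos (2 * m + 1 + n) hN
  have m2 := Int.emod_add_mul_ediv (2 * m + 1 + n) (2 * n)
  rw [← hq] at m2
  -- Subtracting an even number keeps `j` odd, hence nonzero.
  set j := 2 * m + 1 - 2 * n * q with hj
  have hj1 : 1 ≤ |j| := by
    have : j ≠ 0 := by
      intro h0
      have : 2 * (n * q - m) = 1 := by linarith
      omega
    exact Int.one_le_abs this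
  have hj2 : |j| ≤ n := by rw [abs_le]; omega
  have hj1' : (1 : ℝ) ≤ |(j : ℝ)| := by exact_mod_cast hj1
  have hj2' : |(j : ℝ)| ≤ n := by exact_mod_cast hj2
  have e : (2 * m + 1) * δ = j * δ + q * (2 * Real.pi) := by
    rw [hj, ← hδ]; push_cast; ring
  rw [e, Real.cos_add_int_mul_two_pi, ← Real.cos_abs, abs_mul, abs_of_pos hδ0]
  apply Real.cos_le_cos_of_nonneg_of_le_pi hδ0.le
  · rw [← hδ]; exact mul_le_mul_of_nonneg_right hj2' hδ0.le
  · nlinarith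

/-- At the waist a corner is the midpoint of two unit vectors at angle `β + δ` or `β - δ`, so its
norm is the cosine of half that angle. -/
lemma norm_stripCorner_half_le (hδ0 : 0 < δ) (hβ0 : δ ≤ β) (hβ : β + δ ≤ Real.pi) (c : ℤ) :
    ‖stripCorner δ β (1 / 2) c‖ ≤ Real.cos ((β - δ) / 2) := by
  have key : ∀ x y : ℝ, ‖((1 - 1 / 2 : ℝ) : ℂ) * cis x + ((1 / 2 : ℝ) : ℂ) * cis y‖ =
      |Real.cos ((y - x) / 2)| := by
    intro x y
    have : ((1 - 1 / 2 : ℝ) : ℂ) * cis x + ((1 / 2 : ℝ) : ℂ) * cis y =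
        (Real.cos ((y - x) / 2) : ℝ) * cis ((x + y) / 2) := by
      apply Complex.ext
      · rw [add_re, re_ofReal_mul, re_ofReal_mul, re_ofReal_mul, cis_re, cis_re, cis_re]
        have := Real.cos_add_cos y x
        rw [add_comm x y]
        linarith
      · rw [add_im, im_ofReal_mul, im_ofReal_mul, im_ofReal_mul, cis_im, cis_im, cis_im]
        have := Real.sin_add_sin x y
        rw [← Real.cos_neg ((y - x) / 2), show -((y - x) / 2) = (x - y) / 2 by ring]
        linarith
    rw [this, norm_mul, norm_cis, mul_one, norm_real, Real.norm_eq_abs]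
  have hπ := Real.pi_pos
  rw [stripCorner, key]
  obtain ⟨k, rfl | rfl⟩ := Int.even_or_odd' c
  · rw [show (2 * k + 1) / 2 = k by omega, show (2 * k) / 2 = k by omega,
      show (β + δ + 2 * δ * (k : ℝ) - 2 * δ * k) / 2 = (β + δ) / 2 by ring, abs_of_nonneg]
    · apply Real.cos_le_cos_of_nonneg_of_le_pi <;> linarith
    · apply Real.cos_nonneg_of_neg_pi_div_two_le_of_le <;> linarith
  · rw [show (2 * k + 1 + 1) / 2 = k + 1 by omega, show (2 * k + 1) / 2 = k by omega]
    push_cast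
    rw [show (β + δ + 2 * δ * (k : ℝ) - 2 * δ * (k + 1)) / 2 = (β - δ) / 2 by ring, abs_of_nonneg]
    apply Real.cos_nonneg_of_neg_pi_div_two_le_of_le <;> linarith

lemma re_cis_neg_mul_le_norm (ψ : ℝ) (z : ℂ) : (cis (-ψ) * z).re ≤ ‖z‖ := by
  calc _ ≤ ‖cis (-ψ) * z‖ := re_le_norm _
    _ = _ := by rw [norm_mul, norm_cis, one_mul]

/-- The lower half of a sufficiently twisted strip stays within the planes through the edges of
the lower polygon. -/
lemma stripPoint_lt_lower {b : ℝ} (hn : 0 < n) (hδ : n * δ = Real.pi)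
    (hβ0 : δ ≤ β) (hβ : β + δ ≤ Real.pi)
    (hb : Real.cos ((β - δ) / 2) < (Real.cos δ + Real.cos b) / 2) (h0 : 0 < t) (h1 : t ≤ 1 / 2)
    {e : ℤ} {r : ℝ} (hr : r ∈ Icc (0 : ℝ) 1) (k : ℤ) :
    (cis (-((2 * k + 1) * δ)) * stripPoint δ β t e r).re <
      (1 - t) * Real.cos δ + t * Real.cos b := by
  have hn' : (0 : ℝ) < n := by exact_mod_cast hn
  have hδ0 : 0 < δ := pos_of_mul_pos_right (hδ ▸ Real.pi_pos) hn'.le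
  have key : ∀ c, (cis (-((2 * k + 1) * δ)) * stripCorner δ β t c).re <
      (1 - t) * Real.cos δ + t * Real.cos b := by
    intro c
    -- Both sides are affine in `t`. The inequality is weak at `t = 0` by the inradius bound and
    -- strict at `t = 1 / 2` by the waist bound, hence strict in between.
    have hN := (re_cis_neg_mul_le_norm ((2 * k + 1) * δ) _).trans
      (norm_stripCorner_half_le hδ0 hβ0 hβ c)
    rw [re_cis_neg_mul_stripCorner] at hN ⊢
    have hc := cos_odd_mul_le hn hδ (k - (c + 1) / 2)
    rw [← Real.cos_neg, show -((2 * ((k - (c + 1) / 2 : ℤ) : ℝ) + 1) * δ) =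
      2 * δ * ((c + 1) / 2 : ℤ) - (2 * k + 1) * δ by push_cast; ring] at hc
    nlinarith
  exact re_cis_neg_mul_stripPoint_lt hr (key e) (key _)

/-- The upper half of a sufficiently twisted strip stays within the planes through the edges of
the upper polygon. -/
lemma stripPoint_lt_upper {b : ℝ} (hn : 0 < n) (hδ : n * δ = Real.pi)
    (hβ0 : δ ≤ β) (hβ : β + δ ≤ Real.pi)
    (hb : Real.cos ((β - δ) / 2) < (Real.cos δ + Real.cos b) / 2) (h0 : 1 / 2 ≤ t) (h1 : t < 1)
    {e : ℤ} {r : ℝ} (hr : r ∈ Icc (0 : ℝ) 1) (k : ℤ) :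
    (cis (-(β + δ + (2 * k + 1) * δ)) * stripPoint δ β t e r).re <
      (1 - t) * Real.cos b + t * Real.cos δ := by
  have hn' : (0 : ℝ) < n := by exact_mod_cast hn
  have hδ0 : 0 < δ := pos_of_mul_pos_right (hδ ▸ Real.pi_pos) hn'.le
  have key : ∀ c, (cis (-(β + δ + (2 * k + 1) * δ)) * stripCorner δ β t c).re <
      (1 - t) * Real.cos b + t * Real.cos δ := by
    intro c
    have hN := (re_cis_neg_mul_le_norm (β + δ + (2 * k + 1) * δ) _).trans
      (norm_stripCorner_half_le hδ0 hβ0 hβ c)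
    rw [re_cis_neg_mul_stripCorner] at hN ⊢
    have hc := cos_odd_mul_le hn hδ (k - c / 2)
    rw [← Real.cos_neg, show -((2 * ((k - c / 2 : ℤ) : ℝ) + 1) * δ) =
      β + δ + 2 * δ * (c / 2 : ℤ) - (β + δ + (2 * k + 1) * δ) by push_cast; ring] at hc
    nlinarith
  exact re_cis_neg_mul_stripPoint_lt hr (key e) (key _)

end Separation

/-! ### Triangulating full and truncated faces. -/

section Triangles

lemma affineIndependent_of_im_ne_zero {a b c : ℂ}
    (h : ((b - a) * (starRingEnd ℂ) (c - a)).im ≠ 0) : AffineIndependent ℝ ![a, b, c] := by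
  rw [affineIndependent_iff_linearIndependent_vsub ℝ _ (0 : Fin 3),
    ← linearIndependent_equiv (finSuccAboveEquiv (0 : Fin 3))]
  have : ((fun i : { x : Fin 3 // x ≠ 0 } => ![a, b, c] i -ᵥ ![a, b, c] 0) ∘
      finSuccAboveEquiv (0 : Fin 3)) = ![b - a, c - a] := by
    ext i
    fin_cases i <;> simp [finSuccAboveEquiv_apply]
  rw [this, LinearIndependent.pair_iff]
  intro s t hst
  simp only [mul_im, conj_re, conj_im] at h
  have hr := congrArg re hst
  have hi := congrArg im hst
  simp only [add_re, add_im, real_smul, re_ofReal_mul, im_ofReal_mul, zero_re, zero_im] at hr hi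
  constructor
  · apply (mul_eq_zero.1 (?_ : s * _ = 0)).resolve_right h
    linear_combination (c - a).re * hi - (c - a).im * hr
  · apply (mul_eq_zero.1 (?_ : t * _ = 0)).resolve_right h
    linear_combination (b - a).im * hr - (b - a).re * hi

/-- The triangle with three given vertices. -/
noncomputable def mkTriangle (a b c : ℂ) (h : ((b - a) * (starRingEnd ℂ) (c - a)).im ≠ 0) :
    Affine.Triangle ℝ ℂ :=
  ⟨![a, b, c], affineIndependent_of_im_ne_zero h⟩

lemma mem_triHull_mkTriangle {a b c z : ℂ} {h : ((b - a) * (starRingEnd ℂ) (c - a)).im ≠ 0} :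
    z ∈ triHull (mkTriangle a b c h) ↔
      ∃ x y w : ℝ, 0 ≤ x ∧ 0 ≤ y ∧ 0 ≤ w ∧ x + y + w = 1 ∧ x * a + y * b + w * c = z := by
  have hr : Set.range (mkTriangle a b c h).points = {a, b, c} := by
    ext x
    simp [mkTriangle, Matrix.range_cons]
    tauto
  rw [triHull, hr]
  constructor
  · intro hz
    rw [convexHull_insert (by simp), convexHull_pair] at hz
    obtain ⟨p, hp, hz⟩ := mem_convexJoin.1 hz
    obtain ⟨q, ⟨s, t, hs, ht, hst, rfl⟩, s', t', hs', ht', hst', rfl⟩ := hz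
    rw [Set.mem_singleton_iff] at hp
    subst hp
    refine ⟨s', t' * s, t' * t, hs', by positivity, by positivity, ?_, ?_⟩
    · linear_combination hst' + t' * hst
    · simp only [real_smul]; push_cast; ring
  · rintro ⟨x, y, w, hx, hy, hw, h1, rfl⟩
    have := (convex_convexHull ℝ ({a, b, c} : Set ℂ)).sum_mem (t := Finset.univ)
      (w := ![x, y, w]) (z := ![a, b, c])
      (by intro i _; fin_cases i <;> simpa) (by simpa [Fin.sum_univ_three] using h1)
      (by intro i _; apply subset_convexHull; fin_cases i <;> simp)
    simpa [Fin.sum_univ_three] using this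

lemma trapezoid_iff_barycentric {a₀ a₁ b z : ℂ} {τ : ℝ} :
    (∃ t ∈ Icc (0 : ℝ) τ, t ≤ 1 ∧ ∃ r ∈ Icc (0 : ℝ) 1,
      z = (1 - t) * ((1 - r) * a₀ + r * a₁) + t * b) ↔
    ∃ x y w : ℝ, 0 ≤ x ∧ 0 ≤ y ∧ 0 ≤ w ∧ w ≤ τ ∧ x + y + w = 1 ∧ x * a₀ + y * a₁ + w * b = z := by
  constructor
  · rintro ⟨t, ht, ht1, r, hr, rfl⟩
    refine ⟨(1 - t) * (1 - r), (1 - t) * r, t,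
      mul_nonneg (sub_nonneg.2 ht1) (sub_nonneg.2 hr.2), mul_nonneg (sub_nonneg.2 ht1) hr.1, ht.1,
      ht.2, by ring, by push_cast; ring⟩
  · rintro ⟨x, y, w, hx, hy, hw, hwτ, h1, rfl⟩
    refine ⟨w, ⟨hw, hwτ⟩, by linarith, ?_⟩
    rcases eq_or_lt_of_le (show w ≤ 1 by linarith) with rfl | hw1
    · obtain rfl : x = 0 := by linarith
      obtain rfl : y = 0 := by linarith
      exact ⟨0, by simp, by simp⟩
    · have hp : 0 < 1 - w := by linarith
      have hp' : (1 - w : ℂ) ≠ 0 := by exact_mod_cast hp.ne'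
      refine ⟨y / (1 - w), ⟨div_nonneg hy hp.le, (div_le_one hp).2 (by linarith)⟩, ?_⟩
      have : (x : ℂ) = 1 - y - w := by exact_mod_cast (by linarith : x = 1 - y - w)
      rw [this]
      push_cast
      field_simp
      ring

/-- A triangle cut off parallel to its base is triangulable. -/
lemma triangulable_trapezoid {a₀ a₁ b : ℂ} {τ : ℝ} (hτ0 : 0 < τ) (hτ1 : τ ≤ 1)
    (h : ((a₁ - a₀) * (starRingEnd ℂ) (b - a₀)).im ≠ 0) :
    Triangulable {z | ∃ t ∈ Icc (0 : ℝ) τ, t ≤ 1 ∧ ∃ r ∈ Icc (0 : ℝ) 1,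
      z = (1 - t) * ((1 - r) * a₀ + r * a₁) + t * b} := by
  rcases eq_or_lt_of_le hτ1 with rfl | hτ1
  · refine ⟨{mkTriangle a₀ a₁ b h}, Set.finite_singleton _, ?_⟩
    ext z
    rw [Set.biUnion_singleton, mem_triHull_mkTriangle, Set.mem_ofPred_eq,
      trapezoid_iff_barycentric]
    constructor
    · rintro ⟨x, y, w, hx, hy, hw, hw1, h⟩
      exact ⟨x, y, w, hx, hy, hw, h⟩
    · rintro ⟨x, y, w, hx, hy, hw, h⟩
      exact ⟨x, y, w, hx, hy, hw, by linarith, h⟩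
  · have hσ : 0 < 1 - τ := by linarith
    have h₀ : ((a₁ - a₀) * (starRingEnd ℂ) ((1 - τ) * a₀ + τ * b - a₀)).im ≠ 0 := by
      have : ((a₁ - a₀) * (starRingEnd ℂ) ((1 - τ) * a₀ + τ * b - a₀)).im =
          τ * ((a₁ - a₀) * (starRingEnd ℂ) (b - a₀)).im := by
        simp; ring
      rw [this]
      exact mul_ne_zero hτ0.ne' h
    have h₁ : (((1 - τ) * a₀ + τ * b - a₁) *
        (starRingEnd ℂ) ((1 - τ) * a₁ + τ * b - a₁)).im ≠ 0 := by
      have : (((1 - τ) * a₀ + τ * b - a₁) * (starRingEnd ℂ) ((1 - τ) * a₁ + τ * b - a₁)).im =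
          -(τ * (1 - τ)) * ((a₁ - a₀) * (starRingEnd ℂ) (b - a₀)).im := by
        simp; ring
      rw [this]
      exact mul_ne_zero (neg_ne_zero.2 (by positivity)) h
    refine ⟨{mkTriangle _ _ _ h₀, mkTriangle _ _ _ h₁}, by simp, ?_⟩
    ext z
    rw [Set.biUnion_pair, Set.mem_union, mem_triHull_mkTriangle, mem_triHull_mkTriangle,
      Set.mem_ofPred_eq, trapezoid_iff_barycentric]
    have hτ' : (τ : ℂ) ≠ 0 := by exact_mod_cast hτ0.ne'
    have hσ' : (1 - τ : ℂ) ≠ 0 := by exact_mod_cast hσ.ne'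
    constructor
    · rintro ⟨x, y, w, hx, hy, hw, hwτ, h1, rfl⟩
      -- The trapezoid is cut along the diagonal from `a₁` to `(1 - τ) * a₀ + τ * b`, where `x = w /
      -- τ * (1 - τ)`.
      rcases le_or_gt (w / τ * (1 - τ)) x with hc | hc
      · left
        refine ⟨x - w / τ * (1 - τ), y, w / τ, by linarith, hy, by positivity, ?_, ?_⟩
        · field_simp; linear_combination τ * h1
        · push_cast; field_simp; ring
      · right
        have hp : x / (1 - τ) ≤ w / τ := by rw [div_le_iff₀ hσ]; exact hc.le
        have hwτ' : w / τ ≤ 1 := (div_le_one hτ0).2 hwτ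
        have hwe : w / τ * τ = w := by field_simp
        have hxe : x / (1 - τ) * (1 - τ) = x := by field_simp
        refine ⟨y - (w / τ - x / (1 - τ)) * (1 - τ), x / (1 - τ), w / τ - x / (1 - τ),
          by nlinarith, by positivity, by linarith, ?_, ?_⟩
        · linear_combination h1 + hwe + hxe
        · push_cast; field_simp; ring
    · rintro (⟨x, y, w, hx, hy, hw, h1, rfl⟩ | ⟨x, y, w, hx, hy, hw, h1, rfl⟩)
      · refine ⟨x + w * (1 - τ), y, w * τ, by positivity, hy, by positivity, by nlinarith, ?_, ?_⟩
        · linear_combination h1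
        · push_cast; ring
      · refine ⟨y * (1 - τ), x + w * (1 - τ), (y + w) * τ, by positivity, by positivity,
          by positivity, by nlinarith, ?_, ?_⟩
        · linear_combination h1
        · push_cast; ring

/-- A triangle cut off parallel to the side opposite to an apex is triangulable. -/
lemma triangulable_apex {a b₀ b₁ : ℂ} {τ : ℝ} (hτ0 : 0 < τ) (hτ1 : τ ≤ 1)
    (h : ((b₀ - a) * (starRingEnd ℂ) (b₁ - a)).im ≠ 0) :
    Triangulable {z | ∃ t ∈ Icc (0 : ℝ) τ, t ≤ 1 ∧ ∃ r ∈ Icc (0 : ℝ) 1,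
      z = (1 - t) * a + t * ((1 - r) * b₀ + r * b₁)} := by
  have h₀ : (((1 - τ) * a + τ * b₀ - a) *
      (starRingEnd ℂ) ((1 - τ) * a + τ * b₁ - a)).im ≠ 0 := by
    have : (((1 - τ) * a + τ * b₀ - a) * (starRingEnd ℂ) ((1 - τ) * a + τ * b₁ - a)).im =
        τ ^ 2 * ((b₀ - a) * (starRingEnd ℂ) (b₁ - a)).im := by
      simp; ring
    rw [this]
    exact mul_ne_zero (by positivity) h
  refine ⟨{mkTriangle _ _ _ h₀}, Set.finite_singleton _, ?_⟩
  ext z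
  rw [Set.biUnion_singleton, mem_triHull_mkTriangle, Set.mem_ofPred_eq]
  have hτ' : (τ : ℂ) ≠ 0 := by exact_mod_cast hτ0.ne'
  constructor
  · rintro ⟨t, ht, -, r, hr, rfl⟩
    have h1 : t / τ ≤ 1 := (div_le_one hτ0).2 ht.2
    have h0 : 0 ≤ t / τ := div_nonneg ht.1 hτ0.le
    refine ⟨1 - t / τ, t / τ * (1 - r), t / τ * r, by linarith,
      mul_nonneg h0 (sub_nonneg.2 hr.2), mul_nonneg h0 hr.1, by ring, ?_⟩
    push_cast
    field_simp
    ring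
  · rintro ⟨x, y, w, hx, hy, hw, h1, rfl⟩
    refine ⟨τ * (y + w), ⟨by positivity, by nlinarith⟩, by nlinarith, ?_⟩
    have hx : (x : ℂ) = 1 - y - w := by exact_mod_cast (by linarith : x = 1 - y - w)
    rw [hx]
    rcases eq_or_lt_of_le (add_nonneg hy hw) with h0 | h0
    · obtain rfl : y = 0 := by linarith
      obtain rfl : w = 0 := by linarith
      exact ⟨0, by simp, by simp⟩
    · refine ⟨w / (y + w), ⟨by positivity, (div_le_one h0).2 (by linarith)⟩, ?_⟩
      have h0' : (y + w : ℂ) ≠ 0 := by exact_mod_cast h0.ne'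
      push_cast
      field_simp
      ring

end Triangles

/-! ### Unrolling a strip isometrically. -/

section Walls

/-- The point of space with horizontal component `p` and height `z`. -/
noncomputable def toSpace (p : ℂ) (z : ℝ) : EuclideanSpace ℝ (Fin 3) := !₂[p.re, p.im, z]

lemma toSpace_inj {p q : ℂ} {z w : ℝ} : toSpace p z = toSpace q w ↔ p = q ∧ z = w := by
  constructor
  · intro h
    have h0 := congrArg (fun v => v 0) h
    have h1 := congrArg (fun v => v 1) h
    have h2 := congrArg (fun v => v 2) h
    simp only [toSpace] at h0 h1 h2
    exact ⟨Complex.ext h0 h1, h2⟩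
  · rintro ⟨rfl, rfl⟩
    rfl

/-- The affine isometry of the plane onto a plane in space containing the horizontal direction
`I * cis φ`. -/
lemma exists_affineIsometry (φ κ μ : ℝ) (h : κ ^ 2 + μ ^ 2 = 1) (p : ℂ) (z₀ x₀ y₀ : ℝ) :
    ∃ A : ℂ →ᵃⁱ[ℝ] EuclideanSpace ℝ (Fin 3), ∀ x y : ℝ, A (x + y * I) =
      toSpace (p + cis φ * (κ * (y - y₀) + I * (x - x₀))) (z₀ + μ * (y - y₀)) := by
  let L : ℂ →ₗ[ℝ] EuclideanSpace ℝ (Fin 3) :=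
    { toFun := fun z => toSpace (cis φ * (κ * z.im + I * z.re)) (μ * z.im)
      map_add' := by
        intro z w
        ext i
        fin_cases i <;> simp [toSpace] <;> ring
      map_smul' := by
        intro k z
        ext i
        fin_cases i <;> simp [toSpace] <;> ring }
  let A : ℂ →ᵃ[ℝ] EuclideanSpace ℝ (Fin 3) :=
    L.toAffineMap + AffineMap.const ℝ ℂ (toSpace (p - cis φ * (κ * y₀ + I * x₀)) (z₀ - μ * y₀))
  refine ⟨⟨A, ?_⟩, ?_⟩
  · intro z
    have hA : A.linear z = L z := by simp [A]
    rw [hA]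
    have h1 : ‖L z‖ ^ 2 = ‖z‖ ^ 2 := by
      rw [EuclideanSpace.norm_sq_eq, Fin.sum_univ_three, Complex.sq_norm, normSq_apply]
      have h2 : ‖cis φ * (κ * z.im + I * z.re)‖ ^ 2 = κ ^ 2 * z.im ^ 2 + z.re ^ 2 := by
        rw [norm_mul, norm_cis, one_mul, Complex.sq_norm, normSq_apply]
        simp
        ring
      rw [Complex.sq_norm, normSq_apply] at h2
      simp only [L, toSpace, LinearMap.coe_mk, AddHom.coe_mk, Real.norm_eq_abs, sq_abs,
        PiLp.toLp_apply, Matrix.cons_val]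
      linear_combination h2 + z.im ^ 2 * h
    exact (sq_eq_sq₀ (norm_nonneg _) (norm_nonneg _)).1 h1
  · intro x y
    change L (x + y * I) + toSpace _ _ = _
    ext i
    fin_cases i <;> simp [L, toSpace] <;> ring

/-- The place in the plane of a point of a strip after unrolling it: `X + Y * I` is the unrolled
position of the lower corner `0`, and `K` is the unrolled height of the strip, up to sign. -/
noncomputable def unrolled (δ β X Y K t : ℝ) (e : ℤ) (r : ℝ) : ℂ :=
  (X + 2 * Real.sin δ * stripPos t e r + t * (Real.sin δ + Real.sin β) : ℝ) + (Y + K * t : ℝ) * I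

lemma re_ofReal_add_ofReal_mul_I (x y : ℝ) : ((x : ℂ) + y * I).re = x := by simp

lemma im_ofReal_add_ofReal_mul_I (x y : ℝ) : ((x : ℂ) + y * I).im = y := by simp

lemma cis_eq (x : ℝ) : cis x = Real.cos x + I * Real.sin x := by
  rw [cis, exp_mul_I]
  push_cast
  ring

/-- The triangles of a strip have the same shape in space and in the plane. -/
lemma exists_affineIsometry_unrolled {δ β K ζ : ℝ} (hK : K ≠ 0)
    (h : K ^ 2 = (Real.cos δ - Real.cos β) ^ 2 + ζ ^ 2) (X Y z₀ : ℝ) (e : ℤ) :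
    ∃ A : ℂ →ᵃⁱ[ℝ] EuclideanSpace ℝ (Fin 3), ∀ t r : ℝ,
      A (unrolled δ β X Y K t e r) = toSpace (stripPoint δ β t e r) (z₀ + ζ * t) := by
  have hK' : (K : ℂ) ≠ 0 := by exact_mod_cast hK
  obtain ⟨k, rfl | rfl⟩ := Int.even_or_odd' e
  -- The base point is the midpoint of the lower edge `k`, at distance `cos δ` from the axis. The
  -- upper vertex is at angle `β` from its normal, which gives the slope and the shear `sin β`.
  · obtain ⟨A, hA⟩ := exists_affineIsometry ((2 * k + 1) * δ) ((Real.cos β - Real.cos δ) / K)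
      (ζ / K) (by field_simp; linear_combination -h)
      (cis ((2 * k + 1) * δ) * Real.cos δ) z₀ (X + (2 * k + 1) * Real.sin δ) Y
    refine ⟨A, fun t r => ?_⟩
    rw [unrolled, hA, toSpace_inj]
    refine ⟨?_, by field_simp; ring⟩
    simp only [stripPoint, stripCorner, stripPos, cornerPos,
      show (2 * k + 1 + 1) / 2 = k + 1 by omega, show (2 * k + 1) / 2 = k by omega,
      show (2 * k) / 2 = k by omega]
    push_cast
    rw [show 2 * δ * (k : ℝ) = (2 * k + 1) * δ + -δ by ring,
      show 2 * δ * ((k : ℝ) + 1) = (2 * k + 1) * δ + δ by ring,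
      show β + δ + ((2 * k + 1) * δ + -δ) = (2 * k + 1) * δ + β by ring,
      cis_add, cis_add, cis_add, cis_eq (-δ), cis_eq δ, cis_eq β, Real.cos_neg, Real.sin_neg]
    push_cast
    field_simp
    ring
  -- Here the normal is that of the upper edge `k`, and the lower vertex `k + 1` is at angle `-β`
  -- from it. The slant height is the same.
  · obtain ⟨A, hA⟩ := exists_affineIsometry (β + (2 * k + 2) * δ)
      ((Real.cos δ - Real.cos β) / K) (ζ / K) (by field_simp; linear_combination -h)
      (cis (β + (2 * k + 2) * δ) * Real.cos β) z₀
      (X + (2 * k + 2) * Real.sin δ + Real.sin β) Y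
    refine ⟨A, fun t r => ?_⟩
    rw [unrolled, hA, toSpace_inj]
    refine ⟨?_, by field_simp; ring⟩
    simp only [stripPoint, stripCorner, stripPos, cornerPos,
      show (2 * k + 1 + 1 + 1) / 2 = k + 1 by omega, show (2 * k + 1) / 2 = k by omega,
      show (2 * k + 1 + 1) / 2 = k + 1 by omega]
    push_cast
    rw [show β + δ + 2 * δ * (k : ℝ) = β + (2 * k + 2) * δ + -δ by ring,
      show β + δ + 2 * δ * ((k : ℝ) + 1) = β + (2 * k + 2) * δ + δ by ring,
      show 2 * δ * ((k : ℝ) + 1) = β + (2 * k + 2) * δ + -β by ring,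
      cis_add _ (-δ), cis_add _ δ, cis_add _ (-β), cis_eq (-δ), cis_eq δ, cis_eq (-β),
      Real.cos_neg, Real.sin_neg, Real.cos_neg, Real.sin_neg]
    push_cast
    field_simp
    ring

/-- The unrolled cell between the corners `e` and `e + 1` of a strip, up to relative height `τ`. -/
def unrolledCell (δ β X Y K τ : ℝ) (e : ℤ) : Set ℂ :=
  {z | ∃ t ∈ Icc (0 : ℝ) τ, t ≤ 1 ∧ ∃ r ∈ Icc (0 : ℝ) 1, z = unrolled δ β X Y K t e r}

lemma triangulable_unrolledCell {δ β X Y K τ : ℝ} (hδ : Real.sin δ ≠ 0) (hK : K ≠ 0)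
    (hτ0 : 0 < τ) (hτ1 : τ ≤ 1) (e : ℤ) : Triangulable (unrolledCell δ β X Y K τ e) := by
  obtain ⟨k, rfl | rfl⟩ := Int.even_or_odd' e
  · have hu : ∀ t r : ℝ, unrolled δ β X Y K t (2 * k) r =
        (1 - t) * ((1 - r) * ((X + 2 * Real.sin δ * k : ℝ) + (Y : ℝ) * I) +
          r * ((X + 2 * Real.sin δ * (k + 1) : ℝ) + (Y : ℝ) * I)) +
        t * ((X + 2 * Real.sin δ * k + (Real.sin δ + Real.sin β) : ℝ) + (Y + K : ℝ) * I) := by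
      intro t r
      simp only [unrolled, stripPos, cornerPos,
        show (2 * k + 1 + 1) / 2 = k + 1 by omega, show (2 * k + 1) / 2 = k by omega,
        show (2 * k) / 2 = k by omega]
      push_cast
      ring
    simp only [unrolledCell, hu]
    apply triangulable_trapezoid hτ0 hτ1
    have : (((X + 2 * Real.sin δ * (k + 1) : ℝ) + (Y : ℝ) * I -
        ((X + 2 * Real.sin δ * k : ℝ) + (Y : ℝ) * I)) * (starRingEnd ℂ)
        ((X + 2 * Real.sin δ * k + (Real.sin δ + Real.sin β) : ℝ) + (Y + K : ℝ) * I -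
          ((X + 2 * Real.sin δ * k : ℝ) + (Y : ℝ) * I))).im = -(2 * Real.sin δ * K) := by
      simp only [mul_im, conj_re, conj_im, sub_re, sub_im, re_ofReal_add_ofReal_mul_I,
        im_ofReal_add_ofReal_mul_I]
      ring
    rw [this]
    simp [hδ, hK]
  · have hu : ∀ t r : ℝ, unrolled δ β X Y K t (2 * k + 1) r =
        (1 - t) * ((X + 2 * Real.sin δ * (k + 1) : ℝ) + (Y : ℝ) * I) +
        t * ((1 - r) * ((X + 2 * Real.sin δ * k + (Real.sin δ + Real.sin β) : ℝ) +
          (Y + K : ℝ) * I) + r * ((X + 2 * Real.sin δ * (k + 1) +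
          (Real.sin δ + Real.sin β) : ℝ) + (Y + K : ℝ) * I)) := by
      intro t r
      simp only [unrolled, stripPos, cornerPos,
        show (2 * k + 1 + 1 + 1) / 2 = k + 1 by omega, show (2 * k + 1) / 2 = k by omega,
        show (2 * k + 1 + 1) / 2 = k + 1 by omega]
      push_cast
      ring
    simp only [unrolledCell, hu]
    apply triangulable_apex hτ0 hτ1
    have : (((X + 2 * Real.sin δ * k + (Real.sin δ + Real.sin β) : ℝ) + (Y + K : ℝ) * I -
        ((X + 2 * Real.sin δ * (k + 1) : ℝ) + (Y : ℝ) * I)) * (starRingEnd ℂ)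
        ((X + 2 * Real.sin δ * (k + 1) + (Real.sin δ + Real.sin β) : ℝ) + (Y + K : ℝ) * I -
          ((X + 2 * Real.sin δ * (k + 1) : ℝ) + (Y : ℝ) * I))).im = 2 * Real.sin δ * K := by
      simp only [mul_im, conj_re, conj_im, sub_re, sub_im, re_ofReal_add_ofReal_mul_I,
        im_ofReal_add_ofReal_mul_I]
      ring
    rw [this]
    simp [hδ, hK]

end Walls

/-! ### Assembling tori from walls. -/

section Assembly

variable {n : ℕ} {δ L T M : ℝ}

lemma mem_periodLattice_iff {x y : ℝ} :
    ((x : ℂ) + y * I) ∈ periodLattice (L : ℂ) (T + M * I) ↔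
      ∃ l m : ℤ, x = l * L + m * T ∧ y = m * M := by
  rw [mem_periodLattice]
  refine exists_congr fun l => exists_congr fun m => ?_
  rw [eq_comm, Complex.ext_iff]
  simp

/-- A part of a polyhedral torus: the part `t ≤ τ` of a strip of twist `β`, placed at height
`z₀ + ζ * t`, together with its place in the unrolled torus. -/
structure Wall where
  /-- the twist -/
  β : ℝ
  /-- the unrolled abscissa -/
  X : ℝ
  /-- the unrolled ordinate -/
  Y : ℝ
  /-- the signed unrolled height -/
  K : ℝ
  /-- the height of the lower polygon in space -/
  z₀ : ℝ
  /-- the signed height in space -/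
  ζ : ℝ
  /-- the part of the strip that is used -/
  τ : ℝ

/-- Points of two walls coincide in space if and only if they agree modulo the lattice. -/
def Wall.Compatible (δ L T M : ℝ) (w w' : Wall) : Prop :=
  ∀ t ∈ Icc 0 w.τ, t ≤ 1 → ∀ t' ∈ Icc 0 w'.τ, t' ≤ 1 → ∀ e e' : ℤ, ∀ r ∈ Icc (0 : ℝ) 1,
    ∀ r' ∈ Icc (0 : ℝ) 1,
    ((∃ l m : ℤ, w.X + 2 * Real.sin δ * stripPos t e r + t * (Real.sin δ + Real.sin w.β) -
        (w'.X + 2 * Real.sin δ * stripPos t' e' r' + t' * (Real.sin δ + Real.sin w'.β)) =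
        l * L + m * T ∧ w.Y + w.K * t - (w'.Y + w'.K * t') = m * M) ↔
      stripPoint δ w.β t e r = stripPoint δ w'.β t' e' r' ∧ w.z₀ + w.ζ * t = w'.z₀ + w'.ζ * t')

lemma Wall.Compatible.symm {w w' : Wall} (h : w.Compatible δ L T M w') :
    w'.Compatible δ L T M w := by
  intro t ht ht1 t' ht' ht1' e e' r hr r' hr'
  rw [eq_comm (a := stripPoint _ _ _ _ _), eq_comm (a := w'.z₀ + _),
    ← h t' ht' ht1' t ht ht1 e' e r' hr' r hr]
  constructor <;> rintro ⟨l, m, h1, h2⟩ <;> refine ⟨-l, -m, ?_, ?_⟩ <;> push_cast <;> linarith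

/-- The `2 * n` faces of a wall cover a full period in the horizontal direction, so only the
ordinates have to be covered by hypothesis. -/
lemma foldable_of_walls {ι : Type} [Finite ι] (w : ι → Wall) (hn : 0 < n) (hδ : Real.sin δ ≠ 0)
    (hL : L = 2 * n * Real.sin δ)
    (hτ : ∀ i, 0 < (w i).τ ∧ (w i).τ ≤ 1) (hK : ∀ i, (w i).K ≠ 0)
    (hH : ∀ i, (w i).K ^ 2 = (Real.cos δ - Real.cos (w i).β) ^ 2 + (w i).ζ ^ 2)
    (hcov : ∀ y : ℝ, ∃ i, ∃ t ∈ Icc 0 (w i).τ, ∃ m : ℤ, y = (w i).Y + (w i).K * t + m * M)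
    (hcompat : ∀ i j, (w i).Compatible δ L T M (w j)) :
    Foldable (periodLattice (L : ℂ) (T + M * I)) := by
  choose A hA using fun i (e : Fin (2 * n)) => exists_affineIsometry_unrolled (hK i) (hH i)
    (w i).X (w i).Y (w i).z₀ ((e : ℕ) : ℤ)
  refine ⟨ι × Fin (2 * n), inferInstance, fun p => unrolledCell δ (w p.1).β (w p.1).X (w p.1).Y
    (w p.1).K (w p.1).τ ((p.2 : ℕ) : ℤ), fun p => A p.1 p.2, fun p =>
    triangulable_unrolledCell hδ (hK _) (hτ _).1 (hτ _).2 _, ?_, ?_⟩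
  · intro z
    obtain ⟨i, t, ht, m, hm⟩ := hcov z.im
    obtain ⟨e, r, l, hr, hl⟩ := stripPos_surjective hn ht.1
      ((z.re - (w i).X - m * T - t * (Real.sin δ + Real.sin (w i).β)) / (2 * Real.sin δ))
    refine ⟨(i, e), _, ⟨t, ht, ht.2.trans (hτ i).2, r, hr, rfl⟩, ?_⟩
    rw [← re_add_im z, unrolled, add_sub_add_comm, ← sub_mul, ← ofReal_sub, ← ofReal_sub,
      mem_periodLattice_iff]
    refine ⟨l, m, ?_, by linarith⟩
    rw [div_eq_iff (by simpa using hδ)] at hl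
    rw [hL]
    linear_combination hl
  · rintro ⟨i, e⟩ ⟨j, e'⟩ _ ⟨t, ht, ht1, r, hr, rfl⟩ _ ⟨t', ht', ht1', r', hr', rfl⟩
    dsimp only
    rw [hA, hA, toSpace_inj, ← hcompat i j t ht ht1 t' ht' ht1' _ _ r hr r' hr', unrolled,
      unrolled, add_sub_add_comm, ← sub_mul, ← ofReal_sub, ← ofReal_sub, mem_periodLattice_iff]

lemma int_eq_zero_of_abs_mul_lt {m : ℤ} {M : ℝ} (hM : 0 < M) (h : |m * M| < M) : m = 0 := by
  rw [abs_mul, abs_of_pos hM] at h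
  have : |(m : ℝ)| < 1 := by
    by_contra! h1
    nlinarith
  exact Int.abs_lt_one_iff.1 (by exact_mod_cast this)

lemma mul_stripPos_sub_eq_iff (hs : Real.sin δ ≠ 0) {a b : ℝ} {l : ℤ} :
    2 * Real.sin δ * a - 2 * Real.sin δ * b = l * (2 * n * Real.sin δ) ↔ a - b = n * l := by
  rw [show 2 * Real.sin δ * a - 2 * Real.sin δ * b = 2 * Real.sin δ * (a - b) by ring,
    show l * (2 * n * Real.sin δ) = 2 * Real.sin δ * (n * l) by ring,
    mul_right_inj' (by simpa using hs)]

/-- A wall shorter than `M` does not meet its transverse translates, and `ζ ≠ 0` lets the height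
determine `t`. What remains is the simplicity of a single section. -/
lemma Wall.compatible_self (hn : 4 ≤ n) (hδ : n * δ = Real.pi) (hs : Real.sin δ ≠ 0)
    (hL : L = 2 * n * Real.sin δ) (hM : 0 < M)
    {w : Wall} (hβ : |w.β| < Real.pi - 2 * δ) (hK : w.K ≠ 0) (hζ : w.ζ ≠ 0)
    (hKM : |w.K| * w.τ < M) : w.Compatible δ L T M w := by
  subst hL
  intro t ht ht1 t' ht' ht1' e e' r hr r' hr'
  constructor
  · rintro ⟨l, m, h1, h2⟩
    have hm : m = 0 := by
      apply int_eq_zero_of_abs_mul_lt hM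
      rw [← h2, show w.Y + w.K * t - (w.Y + w.K * t') = w.K * (t - t') by ring, abs_mul]
      refine lt_of_le_of_lt (mul_le_mul_of_nonneg_left ?_ (abs_nonneg _)) hKM
      rw [abs_le]
      constructor <;> linarith [ht.1, ht.2, ht'.1, ht'.2]
    subst hm
    obtain rfl : t = t' := by
      apply mul_left_cancel₀ hK
      simp only [Int.cast_zero, zero_mul] at h2
      linarith
    refine ⟨(stripPoint_eq_iff hn hδ hβ ht.1 ht1 hr hr').2 ⟨l, ?_⟩, rfl⟩
    rw [← mul_stripPos_sub_eq_iff hs]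
    simp only [Int.cast_zero, zero_mul] at h1
    linarith
  · rintro ⟨h1, h2⟩
    obtain rfl : t = t' := by
      apply mul_left_cancel₀ hζ
      linarith
    obtain ⟨l, hl⟩ := (stripPoint_eq_iff hn hδ hβ ht.1 ht1 hr hr').1 h1
    refine ⟨l, 0, ?_, by simp⟩
    rw [← mul_stripPos_sub_eq_iff hs] at hl
    simp only [Int.cast_zero, zero_mul]
    linarith

lemma stripPoint_at_zero (δ β β' : ℝ) (e : ℤ) (r : ℝ) :
    stripPoint δ β 0 e r = stripPoint δ β' 0 e r := by
  simp [stripPoint, stripCorner]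

/-- Twists differing by a multiple of `2 * δ` give the same upper polygon with its vertices
relabelled; this is what lets two strips share both rims. -/
lemma stripPoint_at_one {β β' : ℝ} {j : ℤ} (h : β = β' + 2 * δ * j) (e : ℤ) (r : ℝ) :
    stripPoint δ β 1 e r = stripPoint δ β' 1 (e + 2 * j) r := by
  simp only [stripPoint, stripCorner, show (e + 2 * j) / 2 = e / 2 + j by omega,
    show (e + 2 * j + 1) / 2 = (e + 1) / 2 + j by omega, h]
  push_cast
  ring_nf

lemma stripPos_at_one (j e : ℤ) (r : ℝ) : stripPos 1 (e + 2 * j) r = stripPos 1 e r + j := by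
  simp only [stripPos, cornerPos, show (e + 2 * j) / 2 = e / 2 + j by omega,
    show (e + 2 * j + 1) / 2 = (e + 1) / 2 + j by omega]
  push_cast
  ring

lemma stripPoint_ne {b β t : ℝ} {j : ℤ} (hn : 0 < n) (hδ : n * δ = Real.pi)
    (hb : δ ≤ b) (hb' : b ≤ Real.pi) (hβ : δ ≤ β) (hβ' : β + δ ≤ Real.pi)
    (hj : β = -b + 2 * δ * j)
    (hc : Real.cos ((β - δ) / 2) < (Real.cos δ + Real.cos b) / 2)
    (h0 : 0 < t) (h1 : t < 1) {e e' : ℤ} {r r' : ℝ} (hr : r ∈ Icc (0 : ℝ) 1)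
    (hr' : r' ∈ Icc (0 : ℝ) 1) : stripPoint δ (-b) t e r ≠ stripPoint δ β t e' r' := by
  intro h
  have hδ0 : 0 < δ := pos_of_mul_pos_right (hδ ▸ Real.pi_pos) n.cast_nonneg
  rcases le_or_gt t (1 / 2) with ht | ht
  · have h2 := lower_le_stripPoint hδ0 hb hb' h0.le (e := e) hr
    -- The separating plane belongs to the face carrying the outer point: its lower edge is `e / 2`.
    have h3 := stripPoint_lt_lower hn hδ hβ hβ' hc h0 ht (e := e') hr' (e / 2)
    rw [h] at h2
    exact absurd h2 (not_le.2 h3)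
  · have h2 := upper_le_stripPoint hδ0 hb hb' h1.le (e := e) hr
    -- The same upper edge has index `e / 2 - j` in the labelling of the inner strip.
    have h3 := stripPoint_lt_upper hn hδ hβ hβ' hc ht.le h1 (e := e') hr' (e / 2 - j)
    rw [h] at h2
    rw [show β + δ + (2 * ((e / 2 - j : ℤ) : ℝ) + 1) * δ =
      -b + δ + (2 * ((e / 2 : ℤ) : ℝ) + 1) * δ by rw [hj]; push_cast; ring] at h3
    exact absurd h2 (not_le.2 h3)

lemma exists_int_mod {M : ℝ} (hM : 0 < M) (y : ℝ) :
    ∃ (m : ℤ) (s : ℝ), 0 ≤ s ∧ s ≤ M ∧ y = s + m * M := by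
  refine ⟨⌊y / M⌋, y - ⌊y / M⌋ * M, ?_, ?_, by ring⟩
  · have := Int.floor_le (y / M)
    rw [le_div_iff₀ hM] at this
    linarith
  · have := (Int.lt_floor_add_one (y / M)).le
    rw [div_le_iff₀ hM] at this
    linarith

/-- The torus composed of a strip turning backwards and a more twisted strip inside of it. -/
theorem foldable_of_two_strips {b β h H₁ H₂ : ℝ} {j : ℤ} (hn : 4 ≤ n) (hδ : n * δ = Real.pi)
    (hb : δ ≤ b) (hb' : b < Real.pi - 2 * δ) (hβ : δ ≤ β) (hβ' : β < Real.pi - 2 * δ)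
    (hj : β = -b + 2 * δ * j)
    (hc : Real.cos ((β - δ) / 2) < (Real.cos δ + Real.cos b) / 2) (hh : 0 < h)
    (hH₁ : 0 < H₁) (hH₂ : 0 < H₂) (hH₁' : H₁ ^ 2 = (Real.cos δ - Real.cos b) ^ 2 + h ^ 2)
    (hH₂' : H₂ ^ 2 = (Real.cos δ - Real.cos β) ^ 2 + h ^ 2) :
    Foldable (periodLattice ((2 * n * Real.sin δ : ℝ) : ℂ)
      ((2 * j * Real.sin δ - Real.sin b - Real.sin β : ℝ) + (H₁ + H₂ : ℝ) * I)) := by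
  have hn' : (4 : ℝ) ≤ n := by exact_mod_cast hn
  have hδ0 : 0 < δ := pos_of_mul_pos_right (hδ ▸ Real.pi_pos) n.cast_nonneg
  have hs : Real.sin δ ≠ 0 :=
    (Real.sin_pos_of_pos_of_lt_pi hδ0 (by rw [← hδ]; nlinarith)).ne'
  have hb1 : |(-b)| < Real.pi - 2 * δ := by rw [abs_neg, abs_of_pos (by linarith)]; exact hb'
  have hβ1 : |β| < Real.pi - 2 * δ := by rw [abs_of_pos (by linarith)]; exact hβ'
  let T := 2 * j * Real.sin δ - Real.sin b - Real.sin β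
  have hT : T = 2 * j * Real.sin δ - Real.sin b - Real.sin β := rfl
  -- In the unrolled torus `B` climbs from ordinate `0` to `H₁`, and `A` is traversed from its top
  -- at `H₁` to its bottom at `H₁ + H₂`. The offset `T` makes the upper rims match after the shift
  -- by `j`.
  let B : Wall := ⟨-b, 0, 0, H₁, 0, h, 1⟩
  let A : Wall := ⟨β, T, H₁ + H₂, -H₂, 0, h, 1⟩
  have hBB : B.Compatible δ (2 * n * Real.sin δ) T (H₁ + H₂) B := by
    apply Wall.compatible_self hn hδ hs rfl (by positivity) hb1 hH₁.ne' hh.ne'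
    change |H₁| * 1 < _
    rw [abs_of_pos hH₁]
    linarith
  have hAA : A.Compatible δ (2 * n * Real.sin δ) T (H₁ + H₂) A := by
    apply Wall.compatible_self hn hδ hs rfl (by positivity) hβ1 (neg_ne_zero.2 hH₂.ne') hh.ne'
    change |-H₂| * 1 < _
    rw [abs_neg, abs_of_pos hH₂]
    linarith
  have hBA : B.Compatible δ (2 * n * Real.sin δ) T (H₁ + H₂) A := by
    intro t ht ht1 t' ht' ht1' e e' r hr r' hr'
    have hlow : stripPoint δ (-b) 0 e r = stripPoint δ β 0 e' r' ↔
        ∃ l : ℤ, stripPos 0 e r - stripPos 0 e' r' = n * l := by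
      rw [stripPoint_at_zero δ β (-b), stripPoint_eq_iff hn hδ hb1 le_rfl zero_le_one hr hr']
    have hupp : stripPoint δ (-b) 1 e r = stripPoint δ β 1 e' r' ↔
        ∃ l : ℤ, stripPos 1 e r - (stripPos 1 e' r' + j) = n * l := by
      rw [stripPoint_at_one hj, stripPoint_eq_iff hn hδ hb1 zero_le_one le_rfl hr hr',
        stripPos_at_one]
    simp only [B, A] at ht ht' ⊢
    simp only [← mul_stripPos_sub_eq_iff hs] at hlow hupp
    rw [Real.sin_neg]
    constructor
    · rintro ⟨l, m, h1, h2⟩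
      have a1 := mul_nonneg hH₁.le ht.1
      have a2 := mul_nonneg hH₂.le ht'.1
      have a3 := mul_nonneg hH₁.le (sub_nonneg.2 ht1)
      have a4 := mul_nonneg hH₂.le (sub_nonneg.2 ht1')
      have hM : 0 < H₁ + H₂ := by linarith
      -- The difference of ordinates lies in `[-(H₁ + H₂), 0]`; its ends are the lower rim (`m =
      -- -1`) and the upper rim (`m = 0`).
      have hm : m = 0 ∨ m = -1 := by
        have m1 : (m : ℝ) < 1 := by
          by_contra! hc
          nlinarith
        have m2 : (-2 : ℝ) < m := by
          by_contra! hc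
          nlinarith
        have m1' : m < 1 := by exact_mod_cast m1
        have m2' : -2 < m := by exact_mod_cast m2
        omega
      rcases hm with rfl | rfl
      · simp only [Int.cast_zero, zero_mul] at h1 h2
        obtain rfl : t = 1 := by
          have := mul_left_cancel₀ hH₁.ne' (show H₁ * (1 - t) = H₁ * 0 by linarith)
          linarith
        obtain rfl : t' = 1 := by
          have := mul_left_cancel₀ hH₂.ne' (show H₂ * (1 - t') = H₂ * 0 by linarith)
          linarith
        exact ⟨hupp.2 ⟨l, by linarith⟩, rfl⟩
      · push_cast at h1 h2
        obtain rfl : t = 0 := mul_left_cancel₀ hH₁.ne' (by linarith)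
        obtain rfl : t' = 0 := mul_left_cancel₀ hH₂.ne' (by linarith)
        exact ⟨hlow.2 ⟨l, by linarith⟩, rfl⟩
    · rintro ⟨h1, h2⟩
      obtain rfl : t = t' := mul_left_cancel₀ hh.ne' (by linarith)
      rcases eq_or_lt_of_le ht.1 with rfl | h0
      · obtain ⟨l, hl⟩ := hlow.1 h1
        exact ⟨l, -1, by push_cast; linarith, by push_cast; linarith⟩
      · rcases eq_or_lt_of_le ht1 with rfl | h1'
        · obtain ⟨l, hl⟩ := hupp.1 h1
          exact ⟨l, 0, by push_cast; linarith, by push_cast; linarith⟩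
        · exact absurd h1 (stripPoint_ne (by omega) hδ hb (by linarith) hβ (by linarith) hj hc h0
            h1' hr hr')
  refine foldable_of_walls (ι := Fin 2) (n := n) ![B, A] (by omega) hs rfl ?_ ?_ ?_ ?_ ?_
  · intro i; fin_cases i <;> simp [A, B]
  · intro i; fin_cases i <;> simp [A, B, hH₁.ne', hH₂.ne']
  · intro i; fin_cases i <;> simp [A, B, hH₁', hH₂']
  · intro y
    obtain ⟨m, s, hs0, hs1, rfl⟩ := exists_int_mod (show 0 < H₁ + H₂ by linarith) y
    rcases le_total s H₁ with hsH | hsH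
    · refine ⟨0, s / H₁, ⟨by positivity, (div_le_one hH₁).2 hsH⟩, m, ?_⟩
      simp only [B, Matrix.cons_val_zero]
      field_simp
      ring
    · refine ⟨1, (H₁ + H₂ - s) / H₂, ⟨div_nonneg (by linarith) hH₂.le,
        (div_le_one hH₂).2 (by linarith)⟩, m, ?_⟩
      simp only [A, Matrix.cons_val_one, Matrix.cons_val_fin_one]
      field_simp
      ring
  · intro i i'
    fin_cases i <;> fin_cases i'
    exacts [hBB, hBA, hBA.symm, hAA]

/-- The torus composed of a prism and, inside of it, half of a strip and its mirror image. -/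
theorem foldable_of_prism {β h H : ℝ} (hn : 4 ≤ n) (hδ : n * δ = Real.pi)
    (hβ : δ ≤ β) (hβ' : β < Real.pi - 2 * δ)
    (hc : Real.cos ((β - δ) / 2) < Real.cos δ) (hh : 0 < h) (hH : 0 < H)
    (hH' : H ^ 2 = (Real.cos δ - Real.cos β) ^ 2 + (2 * h) ^ 2) :
    Foldable (periodLattice ((2 * n * Real.sin δ : ℝ) : ℂ) ((0 : ℝ) + (2 * h + H : ℝ) * I)) := by
  have hn' : (4 : ℝ) ≤ n := by exact_mod_cast hn
  have hδ0 : 0 < δ := pos_of_mul_pos_right (hδ ▸ Real.pi_pos) n.cast_nonneg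
  have hδπ : 4 * δ ≤ Real.pi := by rw [← hδ]; nlinarith
  have hs : Real.sin δ ≠ 0 := (Real.sin_pos_of_pos_of_lt_pi hδ0 (by linarith)).ne'
  have hδ1 : |(-δ)| < Real.pi - 2 * δ := by rw [abs_neg, abs_of_pos hδ0]; linarith
  have hβ1 : |β| < Real.pi - 2 * δ := by rw [abs_of_pos (by linarith)]; exact hβ'
  -- Twist `-δ` does not turn the upper polygon, so `B` is a vertical prism. `U` descends from its
  -- top and `D` rises from its bottom; they are mirror images and meet in the section `t = 1 / 2`
  -- at height `0`.
  let B : Wall := ⟨-δ, 0, 0, 2 * h, -h, 2 * h, 1⟩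
  let U : Wall := ⟨β, 0, 2 * h, H, h, -(2 * h), 1 / 2⟩
  let D : Wall := ⟨β, 0, 2 * h + H, -H, -h, 2 * h, 1 / 2⟩
  have hM : 0 < 2 * h + H := by positivity
  have hBB : B.Compatible δ (2 * n * Real.sin δ) 0 (2 * h + H) B := by
    apply Wall.compatible_self hn hδ hs rfl hM hδ1 (by positivity : 2 * h ≠ 0)
      (by positivity : 2 * h ≠ 0)
    change |2 * h| * 1 < _
    rw [abs_of_pos (by positivity)]
    linarith
  have hUU : U.Compatible δ (2 * n * Real.sin δ) 0 (2 * h + H) U := by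
    apply Wall.compatible_self hn hδ hs rfl hM hβ1 hH.ne' (neg_ne_zero.2 (by positivity))
    change |H| * (1 / 2) < _
    rw [abs_of_pos (by positivity)]
    linarith
  have hDD : D.Compatible δ (2 * n * Real.sin δ) 0 (2 * h + H) D := by
    apply Wall.compatible_self hn hδ hs rfl hM hβ1 (neg_ne_zero.2 hH.ne')
      (by positivity : 2 * h ≠ 0)
    change |-H| * (1 / 2) < _
    rw [abs_neg, abs_of_pos (by positivity)]
    linarith
  -- For `b = δ` the separating planes are vertical, so points may be compared at different values
  -- of `t` and `t'`.
  have hne : ∀ {t t' : ℝ} {e e' : ℤ} {r r' : ℝ}, 0 ≤ t → 0 < t' → t' ≤ 1 / 2 →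
      r ∈ Icc (0 : ℝ) 1 → r' ∈ Icc (0 : ℝ) 1 →
      stripPoint δ (-δ) t e r ≠ stripPoint δ β t' e' r' := by
    intro t t' e e' r r' ht ht0 ht1 hr hr' h
    have h2 := lower_le_stripPoint hδ0 le_rfl (by linarith) ht (e := e) hr
    have h3 := stripPoint_lt_lower (b := δ) (by omega) hδ hβ (by linarith) (by linarith) ht0 ht1
      (e := e') hr' (e / 2)
    rw [h] at h2
    linarith
  have hBU : B.Compatible δ (2 * n * Real.sin δ) 0 (2 * h + H) U := by
    intro t ht ht1 t' ht' ht1' e e' r hr r' hr'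
    have hlow : stripPoint δ (-δ) 1 e r = stripPoint δ β 0 e' r' ↔
        ∃ l : ℤ, stripPos 1 e r - stripPos 0 e' r' = n * l := by
      -- Corner `c` is at upper vertex `c / 2` when `t = 1` and at lower vertex `(c + 1) / 2` when
      -- `t = 0`, hence the shift by one.
      have e1 : stripPoint δ (-δ) 1 e r = stripPoint δ β 0 (e - 1) r := by
        simp [stripPoint, stripCorner]
      have e2 : stripPos 1 e r = stripPos 0 (e - 1) r := by
        simp [stripPos, cornerPos]
      rw [e1, e2, stripPoint_eq_iff hn hδ hβ1 le_rfl zero_le_one hr hr']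
    simp only [B, U] at ht ht' ⊢
    simp only [← mul_stripPos_sub_eq_iff hs] at hlow
    rw [Real.sin_neg]
    have a2 := mul_nonneg hH.le ht'.1
    have a3 := mul_nonneg hh.le (sub_nonneg.2 ht1)
    constructor
    · rintro ⟨l, m, h1, h2⟩
      have hm : m = 0 := by
        apply int_eq_zero_of_abs_mul_lt hM
        rw [← h2, abs_lt]
        constructor <;> nlinarith [mul_nonneg hH.le (sub_nonneg.2 ht'.2), mul_nonneg hh.le ht.1]
      subst hm
      simp only [Int.cast_zero, zero_mul] at h1 h2
      obtain rfl : t' = 0 := mul_left_cancel₀ hH.ne' (by linarith)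
      obtain rfl : t = 1 := by
        have := mul_left_cancel₀ hh.ne' (show h * (1 - t) = h * 0 by linarith)
        linarith
      exact ⟨hlow.2 ⟨l, by linarith⟩, by ring⟩
    · rintro ⟨h1, h2⟩
      rcases eq_or_lt_of_le ht'.1 with rfl | h0
      · obtain rfl : t = 1 := mul_left_cancel₀ hh.ne' (by linarith)
        obtain ⟨l, hl⟩ := hlow.1 h1
        exact ⟨l, 0, by push_cast; linarith, by push_cast; linarith⟩
      · exact absurd h1 (hne ht.1 h0 ht'.2 hr hr')
  have hBD : B.Compatible δ (2 * n * Real.sin δ) 0 (2 * h + H) D := by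
    intro t ht ht1 t' ht' ht1' e e' r hr r' hr'
    have hlow : stripPoint δ (-δ) 0 e r = stripPoint δ β 0 e' r' ↔
        ∃ l : ℤ, stripPos 0 e r - stripPos 0 e' r' = n * l := by
      rw [stripPoint_at_zero δ β (-δ), stripPoint_eq_iff hn hδ hδ1 le_rfl zero_le_one hr hr']
    simp only [B, D] at ht ht' ⊢
    simp only [← mul_stripPos_sub_eq_iff hs] at hlow
    rw [Real.sin_neg]
    have a1 := mul_nonneg hh.le ht.1
    have a2 := mul_nonneg hH.le ht'.1
    constructor
    · rintro ⟨l, m, h1, h2⟩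
      have hm : m + 1 = 0 := by
        apply int_eq_zero_of_abs_mul_lt hM
        push_cast
        rw [add_mul, ← h2, abs_lt]
        constructor <;> nlinarith [mul_nonneg hH.le (sub_nonneg.2 ht'.2),
          mul_nonneg hh.le (sub_nonneg.2 ht1)]
      obtain rfl : m = -1 := by omega
      push_cast at h1 h2
      obtain rfl : t = 0 := mul_left_cancel₀ hh.ne' (by linarith)
      obtain rfl : t' = 0 := mul_left_cancel₀ hH.ne' (by linarith)
      exact ⟨hlow.2 ⟨l, by linarith⟩, by ring⟩
    · rintro ⟨h1, h2⟩
      rcases eq_or_lt_of_le ht'.1 with rfl | h0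
      · obtain rfl : t = 0 := mul_left_cancel₀ hh.ne' (by linarith)
        obtain ⟨l, hl⟩ := hlow.1 h1
        exact ⟨l, -1, by push_cast; linarith, by push_cast; linarith⟩
      · exact absurd h1 (hne ht.1 h0 ht'.2 hr hr')
  have hUD : U.Compatible δ (2 * n * Real.sin δ) 0 (2 * h + H) D := by
    intro t ht ht1 t' ht' ht1' e e' r hr r' hr'
    have hmid := stripPoint_eq_iff hn hδ hβ1 (t := 1 / 2) (by norm_num) (by norm_num)
      (e := e) (e' := e') hr hr'
    simp only [U, D] at ht ht' ⊢
    simp only [← mul_stripPos_sub_eq_iff hs] at hmid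
    constructor
    · rintro ⟨l, m, h1, h2⟩
      have hm : m = 0 := by
        apply int_eq_zero_of_abs_mul_lt hM
        rw [← h2, abs_lt]
        constructor <;> nlinarith [mul_nonneg hH.le (sub_nonneg.2 ht'.2),
          mul_nonneg hH.le (sub_nonneg.2 ht.2), mul_nonneg hH.le ht.1, mul_nonneg hH.le ht'.1]
      subst hm
      simp only [Int.cast_zero, zero_mul] at h1 h2
      have hsum : t + t' = 1 := mul_left_cancel₀ hH.ne' (by linarith)
      obtain rfl : t = 1 / 2 := by linarith [ht.2, ht'.2]
      obtain rfl : t' = 1 / 2 := by linarith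
      exact ⟨hmid.2 ⟨l, by linarith⟩, by ring⟩
    · rintro ⟨h1, h2⟩
      have hsum : t + t' = 1 := mul_left_cancel₀ hh.ne' (by linarith)
      obtain rfl : t = 1 / 2 := by linarith [ht.2, ht'.2]
      obtain rfl : t' = 1 / 2 := by linarith
      obtain ⟨l, hl⟩ := hmid.1 h1
      exact ⟨l, 0, by push_cast; linarith, by push_cast; linarith⟩
  refine foldable_of_walls (ι := Fin 3) (n := n) ![B, U, D] (by omega) hs rfl ?_ ?_ ?_ ?_ ?_
  · intro i; fin_cases i <;> norm_num [B, U, D]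
  · intro i; fin_cases i <;> simp [B, U, D, hh.ne', hH.ne']
  · intro i; fin_cases i <;> simp [B, U, D, hH']
  · intro y
    obtain ⟨m, s, hs0, hs1, rfl⟩ := exists_int_mod hM y
    rcases le_total s (2 * h) with hsH | hsH
    · refine ⟨0, s / (2 * h), ⟨by positivity, (div_le_one (by positivity)).2 hsH⟩, m, ?_⟩
      simp only [B, Matrix.cons_val]
      field_simp
      ring
    · rcases le_total s (2 * h + H / 2) with hsH' | hsH'
      · refine ⟨1, (s - 2 * h) / H, ⟨div_nonneg (by linarith) hH.le,
          (div_le_iff₀ hH).2 (by change _ ≤ 1 / 2 * H; linarith)⟩, m, ?_⟩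
        simp only [U, Matrix.cons_val]
        field_simp
        ring
      · refine ⟨2, (2 * h + H - s) / H, ⟨div_nonneg (by linarith) hH.le,
          (div_le_iff₀ hH).2 (by change _ ≤ 1 / 2 * H; linarith)⟩, m, ?_⟩
        simp only [D, Matrix.cons_val]
        field_simp
        ring
  · intro i i'
    fin_cases i <;> fin_cases i'
    exacts [hBB, hBU, hBD, hBU.symm, hUU, hUD, hBD.symm, hUD.symm, hDD]

end Assembly

/-! ### Realizing every modulus. -/

section Moduli

lemma Foldable.scale {L T M x y : ℝ} (hL : 0 < L) (hT : T = L * x) (hM : M = L * y)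
    (h : Foldable (periodLattice (L : ℂ) (T + M * I))) : Foldable (periodLattice 1 (x + y * I)) := by
  have hL' : (L : ℂ) ≠ 0 := by exact_mod_cast hL.ne'
  have e1 : (L : ℂ)⁻¹ * L = 1 := inv_mul_cancel₀ hL'
  have e2 : (L : ℂ)⁻¹ * (T + M * I) = x + y * I := by
    rw [hT, hM]; push_cast; field_simp
  refine h.of_similarity ((LinearEquiv.smulOfNeZero ℂ ℂ (L : ℂ)⁻¹
    (inv_ne_zero hL')).restrictScalars ℝ) (inv_pos.2 hL)
    (fun v => by simp [abs_of_pos hL]) ?_ ?_ ?_ ?_ <;>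
    simp only [LinearEquiv.restrictScalars_apply, LinearEquiv.smulOfNeZero_apply, smul_eq_mul,
      e1, e2, mem_periodLattice]
  · exact ⟨1, 0, by simp⟩
  · exact ⟨0, 1, by simp⟩
  · exact ⟨1, 0, by simp⟩
  · exact ⟨0, 1, by simp⟩

lemma foldable_rectangular {y : ℝ} (hy : 1 ≤ y) :
    Foldable (periodLattice 1 ((0 : ℝ) + y * I)) := by
  have hπ := Real.pi_pos
  set δ := Real.pi / 8 with hδ
  have hsin : 1 / 4 ≤ Real.sin δ := by
    have := Real.mul_le_sin (x := δ) (by positivity) (by rw [hδ]; linarith)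
    rw [hδ] at this ⊢
    convert this using 1
    field_simp
    norm_num
  set L := 2 * (8 : ℕ) * Real.sin δ with hL
  have hL4 : 4 ≤ L := by rw [hL]; push_cast; linarith
  set k := Real.cos δ with hk
  have hk1 : k ≤ 1 := Real.cos_le_one _
  have hk0 : 0 ≤ k := Real.cos_nonneg_of_neg_pi_div_two_le_of_le (by linarith) (by linarith)
  set M := L * y with hM
  have hM4 : 4 ≤ M := by rw [hM]; nlinarith
  have hMk : 0 < M ^ 2 - k ^ 2 := by nlinarith
  -- The values of `h` and `H` solve `2 * h + H = M` and `H ^ 2 - (2 * h) ^ 2 = k ^ 2`.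
  have := foldable_of_prism (n := 8) (δ := δ) (β := Real.pi / 2) (h := (M ^ 2 - k ^ 2) / (4 * M))
    (H := (M ^ 2 + k ^ 2) / (2 * M)) (by norm_num) (by rw [hδ]; push_cast; ring)
    (by linarith) (by linarith)
    (Real.cos_lt_cos_of_nonneg_of_le_pi (by linarith) (by linarith) (by linarith))
    (by positivity) (by positivity) (by rw [Real.cos_pi_div_two, ← hk]; field_simp; ring)
  refine this.scale (by linarith) (by simp) ?_
  rw [← hL, ← hM]
  field_simp
  ring

/-- This is the limiting condition on the twists: for `b = β / 2` and `n → ∞`, the rim translation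
tends to `β + b - sin b - sin β` and the perimeter to `2 * π`. At `β = π` the left side is `3 * π /
2 - 1`, which exceeds `π ≥ 2 * π * x`. -/
lemma exists_twist {x : ℝ} (hx0 : 0 < x) (hx1 : x ≤ 1 / 2) : ∃ β : ℝ, 0 < β ∧ β < Real.pi ∧
    β - Real.sin β + (β / 2 - Real.sin (β / 2)) = 2 * Real.pi * x := by
  have hπ := Real.pi_gt_three
  have := intermediate_value_Ioo Real.pi_pos.le
    (f := fun β => β - Real.sin β + (β / 2 - Real.sin (β / 2))) (by fun_prop)
  obtain ⟨β, hβ, h⟩ := this (show 2 * Real.pi * x ∈ _ by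
    simp only [Real.sin_zero, zero_div, Real.sin_pi, Real.sin_pi_div_two]
    constructor
    · simp only [sub_zero, add_zero]; positivity
    · nlinarith)
  exact ⟨β, hβ.1, hβ.2, h⟩

-- Write `b = u - γ` and `β = u + γ` with `u = δ * j`. Then `sin b + sin β = 2 * sin u * cos γ`, so
-- the prescribed translation holds exactly when `cos γ = g`. With `u` tending to `3 * B / 4`, `γ`
-- tends to `B / 4`, so `b` tends to `B / 2` and `β` to `B`; the remaining conditions are strict
-- inequalities holding in the limit.
open Filter Topology in
lemma exists_strip_parameters {x : ℝ} (hx0 : 0 < x) (hx1 : x ≤ 1 / 2) :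
    ∃ (n : ℕ) (j : ℤ) (δ b β : ℝ), 4 ≤ n ∧ n * δ = Real.pi ∧ δ ≤ b ∧ b < Real.pi - 2 * δ ∧
      δ ≤ β ∧ β < Real.pi - 2 * δ ∧ β = -b + 2 * δ * j ∧
      Real.cos ((β - δ) / 2) < (Real.cos δ + Real.cos b) / 2 ∧ 5 ≤ 2 * n * Real.sin δ ∧
      2 * j * Real.sin δ - Real.sin b - Real.sin β = 2 * n * Real.sin δ * x := by
  obtain ⟨B, hB0, hBπ, hB⟩ := exists_twist hx0 hx1
  have hπ := Real.pi_pos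
  let δ : ℕ → ℝ := fun n => Real.pi / n
  let j : ℕ → ℤ := fun n => ⌊3 * B / 4 / δ n⌋
  let u : ℕ → ℝ := fun n => δ n * j n
  let g : ℕ → ℝ := fun n => (j n - n * x) * Real.sin (δ n) / Real.sin (u n)
  let γ : ℕ → ℝ := fun n => Real.arccos (g n)
  have hδ : Tendsto δ atTop (𝓝 0) := tendsto_const_div_atTop_nhds_zero_nat _
  have hδ0 : ∀ᶠ n in atTop, 0 < δ n := by
    filter_upwards [eventually_gt_atTop 0] with n hn
    have : (0 : ℝ) < n := by exact_mod_cast hn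
    positivity
  have hu : Tendsto u atTop (𝓝 (3 * B / 4)) := by
    have h1 : Tendsto (fun n => 3 * B / 4 - δ n) atTop (𝓝 (3 * B / 4)) := by
      simpa using tendsto_const_nhds.sub hδ
    refine tendsto_of_tendsto_of_tendsto_of_le_of_le' h1 tendsto_const_nhds ?_ ?_
    · filter_upwards [hδ0] with n hn
      have := (Int.lt_floor_add_one (3 * B / 4 / δ n)).le
      rw [div_le_iff₀ hn] at this
      simp only [u, j]
      linarith
    · filter_upwards [hδ0] with n hn
      have := Int.floor_le (3 * B / 4 / δ n)
      rw [le_div_iff₀ hn] at this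
      simp only [u, j]
      linarith
  have hq : Tendsto (fun n : ℕ => n * Real.sin (δ n)) atTop (𝓝 Real.pi) := by
    have h1 : Tendsto (fun n : ℕ => Real.pi * Real.sinc (δ n)) atTop (𝓝 (Real.pi * 1)) := by
      rw [← Real.sinc_zero]
      exact tendsto_const_nhds.mul ((Real.continuous_sinc.tendsto 0).comp hδ)
    rw [mul_one] at h1
    refine h1.congr' ?_
    filter_upwards [hδ0, eventually_gt_atTop 0] with n hn hn0
    have : (0 : ℝ) < n := by exact_mod_cast hn0
    rw [Real.sinc_of_ne_zero hn.ne']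
    simp only [δ]
    field_simp
  have hsin : 0 < Real.sin (3 * B / 4) := Real.sin_pos_of_pos_of_lt_pi (by linarith) (by linarith)
  have hsu : Tendsto (fun n => Real.sin (u n)) atTop (𝓝 (Real.sin (3 * B / 4))) :=
    (Real.continuous_sin.tendsto _).comp hu
  have hg : Tendsto g atTop (𝓝 (Real.cos (B / 4))) := by
    have h1 : Tendsto (fun n => (u n / Real.pi - x) * (n * Real.sin (δ n)) / Real.sin (u n)) atTop
        (𝓝 ((3 * B / 4 / Real.pi - x) * Real.pi / Real.sin (3 * B / 4))) :=
      (((hu.div_const _).sub_const _).mul hq).div hsu hsin.ne'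
    have h2 : (3 * B / 4 / Real.pi - x) * Real.pi / Real.sin (3 * B / 4) = Real.cos (B / 4) := by
      have h3 := Real.sin_add_sin B (B / 2)
      rw [show (B + B / 2) / 2 = 3 * B / 4 by ring, show (B - B / 2) / 2 = B / 4 by ring] at h3
      rw [div_eq_iff hsin.ne']
      field_simp
      linarith
    rw [h2] at h1
    refine h1.congr' ?_
    filter_upwards [eventually_gt_atTop 0] with n hn0
    have : (0 : ℝ) < n := by exact_mod_cast hn0
    simp only [g, u, δ]
    field_simp
  have hγ : Tendsto γ atTop (𝓝 (B / 4)) := by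
    have := (Real.continuous_arccos.tendsto _).comp hg
    rwa [Real.arccos_cos (by linarith) (by linarith)] at this
  have hb : Tendsto (fun n => u n - γ n) atTop (𝓝 (B / 2)) := by
    convert hu.sub hγ using 2; ring
  have hβ : Tendsto (fun n => u n + γ n) atTop (𝓝 B) := by
    convert hu.add hγ using 2; ring
  have hπδ : Tendsto (fun n => Real.pi - 2 * δ n) atTop (𝓝 Real.pi) := by
    simpa using tendsto_const_nhds.sub (hδ.const_mul 2)
  have hcos1 : Tendsto (fun n => Real.cos ((u n + γ n - δ n) / 2)) atTop
      (𝓝 (Real.cos ((B - 0) / 2))) :=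
    (Real.continuous_cos.tendsto _).comp ((hβ.sub hδ).div_const 2)
  have hcos2 : Tendsto (fun n => (Real.cos (δ n) + Real.cos (u n - γ n)) / 2) atTop
      (𝓝 ((Real.cos 0 + Real.cos (B / 2)) / 2)) :=
    (((Real.continuous_cos.tendsto _).comp hδ).add
      ((Real.continuous_cos.tendsto _).comp hb)).div_const 2
  have hlt : ∀ {a : ℝ}, 0 < a → a < Real.pi → Real.cos a < 1 := fun {a} h0 h1 => by
    rw [← Real.cos_zero]
    exact Real.cos_lt_cos_of_nonneg_of_le_pi le_rfl h1.le h0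
  have E1 := hδ.eventually_lt hb (by linarith)
  have E2 := hb.eventually_lt hπδ (by linarith)
  have E3 := hδ.eventually_lt hβ (by linarith)
  have E4 := hβ.eventually_lt hπδ (by linarith)
  -- In the limit this reads `cos (B / 2) < (1 + cos (B / 2)) / 2`, that is `cos (B / 2) < 1`: the
  -- reason for aiming at `b = β / 2`.
  have E5 := hcos1.eventually_lt hcos2 (by
    rw [sub_zero, Real.cos_zero]
    linarith [hlt (a := B / 2) (by linarith) (by linarith)])
  have E6 := hq.eventually_const_lt (u := 5 / 2) (by linarith [Real.pi_gt_three])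
  have E7 := hg.eventually_lt_const (hlt (a := B / 4) (by linarith) (by linarith))
  have E8 := hg.eventually_const_lt (u := -1) (by
    linarith [Real.cos_pos_of_mem_Ioo (x := B / 4) ⟨by linarith, by linarith⟩])
  have E9 := hsu.eventually_const_lt hsin
  obtain ⟨n, e1, e2, e3, e4, e5, e6, e7, e8, e9, hn⟩ :=
    (E1.and <| E2.and <| E3.and <| E4.and <| E5.and <| E6.and <| E7.and <| E8.and <| E9.and <|
      eventually_ge_atTop 4).exists
  have hn' : (0 : ℝ) < n := by exact_mod_cast (by omega : 0 < n)
  refine ⟨n, j n, δ n, u n - γ n, u n + γ n, hn, ?_, e1.le, e2, e3.le, e4, ?_, e5, by linarith, ?_⟩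
  · simp only [δ]; field_simp
  · simp only [u]; ring
  · have h1 := Real.sin_add_sin (u n - γ n) (u n + γ n)
    rw [show (u n - γ n + (u n + γ n)) / 2 = u n by ring,
      show (u n - γ n - (u n + γ n)) / 2 = -γ n by ring, Real.cos_neg,
      Real.cos_arccos e8.le e7.le] at h1
    have h2 : Real.sin (u n) * g n = (j n - n * x) * Real.sin (δ n) := by
      simp only [g]; field_simp
    linear_combination -h1 - 2 * h2

/-- The sum of slant heights is `|k₁| + |k₂|` for flattened strips and at least `M` at `h = M`; the
intermediate value theorem gives a height in between. -/
lemma exists_heights {k₁ k₂ M : ℝ} (h : |k₁| + |k₂| < M) : ∃ h : ℝ, 0 < h ∧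
    √(k₁ ^ 2 + h ^ 2) + √(k₂ ^ 2 + h ^ 2) = M := by
  have hM : 0 < M := lt_of_le_of_lt (by positivity) h
  have := intermediate_value_Ioc hM.le
    (f := fun h : ℝ => √(k₁ ^ 2 + h ^ 2) + √(k₂ ^ 2 + h ^ 2)) (by fun_prop)
  obtain ⟨z, hz, hz'⟩ := this (show M ∈ _ by
    constructor
    · simpa [Real.sqrt_sq_eq_abs] using h
    · have h1 : M ≤ √(k₁ ^ 2 + M ^ 2) := Real.le_sqrt_of_sq_le (by nlinarith)
      have h2 := Real.sqrt_nonneg (k₂ ^ 2 + M ^ 2)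
      linarith)
  exact ⟨z, hz.1, hz'⟩

lemma foldable_skew {x y : ℝ} (hx0 : 0 < x) (hx1 : x ≤ 1 / 2) (hy : 0 < y)
    (hxy : 1 ≤ x ^ 2 + y ^ 2) : Foldable (periodLattice 1 (x + y * I)) := by
  obtain ⟨n, j, δ, b, β, hn, hδ, hb, hb', hβ, hβ', hj, hc, hL, hT⟩ :=
    exists_strip_parameters hx0 hx1
  -- Together with a perimeter of at least `5`, this makes the required sum of slant heights exceed
  -- `4 ≥ |k₁| + |k₂|`.
  have hy' : 4 / 5 < y := by nlinarith
  have hk : ∀ a : ℝ, |Real.cos δ - Real.cos a| ≤ 2 := fun a => by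
    rw [abs_le]
    constructor <;> linarith [Real.cos_le_one δ, Real.cos_le_one a, Real.neg_one_le_cos δ,
      Real.neg_one_le_cos a]
  obtain ⟨h, hh, hH⟩ := exists_heights (k₁ := Real.cos δ - Real.cos b)
    (k₂ := Real.cos δ - Real.cos β) (M := 2 * n * Real.sin δ * y) (by nlinarith [hk b, hk β])
  have p : ∀ k : ℝ, 0 < k ^ 2 + h ^ 2 := fun k => by positivity
  have := foldable_of_two_strips hn hδ hb hb' hβ hβ' hj hc hh (Real.sqrt_pos.2 (p _))
    (Real.sqrt_pos.2 (p _)) (Real.sq_sqrt (p _).le) (Real.sq_sqrt (p _).le)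
  exact this.scale (by linarith) hT hH

end Moduli

end

theorem theorem1 (τ : ℂ) (hτ : τ.im ≠ 0) (ω₁ ω₂ : ℂ) (hω₁ : ω₁ ≠ 0) (hmod : ω₂ / ω₁ = τ) :
    ∃ f : FlatTorus ω₁ ω₂ → EuclideanSpace ℝ (Fin 3), IsOrigamiEmbedding f := by
  refine exists_isOrigamiEmbedding_of_fundamental_domain (fun x y hx0 hx1 hy hxy => ?_) hω₁
    (hmod ▸ hτ)
  rcases eq_or_lt_of_le hx0 with rfl | hx0
  · exact foldable_rectangular (by nlinarith)
  · exact foldable_skew hx0 hx1 hy hxy
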